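/- Fix real numbers $0<\mathfrak n_1<\mathfrak n_2$ and $s_-<s_+$, and let $\widehat{\mathbb C}=\mathbb C\cup\{\infty\}$ be the Riemann sphere. Let $\operatorname{Arg}_0$ denote the principal argument with values in $(-\pi,\pi]$, and $\inf\varnothing=+\infty$. Controls. For an interval $I$ let $\mathbb F_I$ be the set of $\varepsilon\in L^\infty_{\mathbb R}(I)$ with $\mathfrak n_1^2\le\varepsilon\le\mathfrak n_2^2$ a.e. on $I$; write $\mathbb F_{s_-}$ for $I=(s_-,+\infty)$ and $\mathbb F_{s_-,s_+}$ for $I=(s_-,s_+)$. For $\kappa\in\mathbb C\setminus\{0\}$ and $\varepsilon\in\mathbb F_{s_-}$ consider on $\widehat{\mathbb C}$ the system $$x'(s)=\mathrm i\kappa\,(-x(s)^2+\varepsilon(s)),\qquad\text{which for }\widetilde x=-1/x\text{ near }x=\infty\text{ reads}\quad \widetilde x'(s)=\mathrm i\kappa\,(-1+\varepsilon(s)\,\widetilde x(s)^2).\tag{R}$$ The control $\varepsilon$ steers $\eta_-\in\widehat{\mathbb C}$ to $\eta_+\in\widehat{\mathbb C}$ in time $t\ge0$ if there is a (Carathéodory)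 solution $x:[s_-,s_-+t]\to\widehat{\mathbb C}$ of (R) with $x(s_-)=\eta_-$ and $x(s_-+t)=\eta_+$. The system is controllable from $\eta_-$ to $\eta_+$ if some $\varepsilon\in\mathbb F_{s_-}$ does this in some finite time. $T^{\min}_\kappa(\eta_-,\eta_+)\in[0,+\infty]$ is the infimum of all $t\ge 0$ for which some $\varepsilon\in\mathbb F_{s_-}$ steers $\eta_-$ to $\eta_+$ in time $t$; a minimum-time control is an $\varepsilon\in\mathbb F_{s_-}$ that steers $\eta_-$ to $\eta_+$ in time exactly $T^{\min}_\kappa(\eta_-,\eta_+)<+\infty$. Resonators. For $\varepsilon\in\mathbb F_{s_-,s_+}$, a number $\kappa\ne0$ is an $(\eta_-;\eta_+)$-eigenvalue of $\varepsilon$, written $\kappa\in\Sigma^{s_-,s_+}_{\eta_-,\eta_+}(\varepsilon)$, if $y''=-\kappa^2\varepsilon y$ a.e. on $(s_-,s_+)$ has a nontrivial solution $y\in W^{2,\infty}(s_-,s_+)$ with $\dfrac{y'(s_\pm)}{\mathrm i\kappa\,y(s_\pm)}=\eta_\pm$ (understood as $y(s_\pm)=0$ when $\eta_\pm=\infty$).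 Put $\Sigma^{s_-,s_+}_{\eta_-,\eta_+}[\mathbb F_{s_-,s_+}]=\bigcup_{\varepsilon\in\mathbb F_{s_-,s_+}}\Sigma^{s_-,s_+}_{\eta_-,\eta_+}(\varepsilon)$ and $$\rho_{\min}(\gamma)=\inf\{|\kappa|:\kappa\in\Sigma^{s_-,s_+}_{\eta_-,\eta_+}[\mathbb F_{s_-,s_+}],\ \operatorname{Arg}_0\kappa=\gamma\}\in[0,+\infty].$$ A resonator of minimal modulus for $\gamma$ is an $\varepsilon\in\mathbb F_{s_-,s_+}$ such that $\rho_{\min}(\gamma)<+\infty$ and $\mathrm e^{\mathrm i\gamma}\rho_{\min}(\gamma)\in\Sigma^{s_-,s_+}_{\eta_-,\eta_+}(\varepsilon)$. Theorem. Let $\eta_-,\eta_+\in\widehat{\mathbb C}$ with $\eta_-\ne\eta_+$, let $\kappa\in\mathbb C\setminus\{0\}$ and $\gamma=\operatorname{Arg}_0\kappa$. The following statements are equivalent: (i) the system (R) is controllable from $\eta_-$ to $\eta_+$; (ii) there exists a minimum-time control $\varepsilon\in\mathbb F_{s_-}$ that steers $\eta_-$ to $\eta_+$; (iii) $\gamma$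 is achievable over $\mathbb F_{s_-,s_+}$, i.e. $\gamma=\operatorname{Arg}_0\kappa'$ for some $\kappa'\in\Sigma^{s_-,s_+}_{\eta_-,\eta_+}[\mathbb F_{s_-,s_+}]$; (iv) there exists at least one resonator of minimal modulus for $\gamma$ over $\mathbb F_{s_-,s_+}$. If (i)-(iv) hold, then $$T^{\min}_\kappa(\eta_-,\eta_+)=\frac{(s_+-s_-)\,\rho_{\min}(\gamma)}{|\kappa|}.$$ If, additionally, $s_+-s_-=T^{\min}_\kappa(\eta_-,\eta_+)$, then the set of restrictions to $(s_-,s_+)$ of the minimum-time controls from $\eta_-$ to $\eta_+$ coincides, as a subset of $L^\infty_{\mathbb R}(s_-,s_+)$, with the set of resonators of minimal modulus for $\gamma$. -/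

import Mathlib

open MeasureTheory Set
open scoped ENNReal NNReal

noncomputable section

namespace Resonator

/-- The Riemann sphere, as the one-point compactification of the complex plane. -/
abbrev Sphere : Type := OnePoint ℂ

/-- The chart `x ↦ x` on `ℂ ⊂ Ĉ`. The value at `∞` is a dummy. -/
def chart : Sphere → ℂ
  | OnePoint.infty => 0
  | OnePoint.some z => z

/-- The chart `x ↦ -1/x` on `Ĉ \ {0}`, with `∞ ↦ 0`. The value at `0` is a dummy. -/
def chartInf : Sphere → ℂ
  | OnePoint.infty => 0
  | OnePoint.some z => -z⁻¹

/-- The real space `L^∞(I)` of classes of a.e. equal functions. -/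
abbrev Linf (I : Set ℝ) : Type := Lp ℝ ∞ (volume.restrict I)

/-- Restriction `L^∞(I) → L^∞(J)` for `J ⊆ I`. -/
def restrictLinf {I J : Set ℝ} (h : J ⊆ I) (ε : Linf I) : Linf J :=
  ((Lp.memLp ε).mono_measure (Measure.restrict_mono h le_rfl)).toLp ε

/-- The family of feasible coefficients `n₁² ≤ ε ≤ n₂²` a.e. on `I`. With `I = (sm, ∞)` these are
the feasible controls, with `I = (sm, sp)` the feasible resonators. -/
def Feasible (n₁ n₂ : ℝ) (I : Set ℝ) : Set (Linf I) :=
  {ε | ∀ᵐ s ∂(volume.restrict I), n₁ ^ 2 ≤ ε s ∧ ε s ≤ n₂ ^ 2}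

/-- `x` is a (Carathéodory) solution on `[a, b]`, in the state space `Ĉ`, of the control system
`x' = iκ(-x² + ε)`, which in the chart `w = -1/x` reads `w' = iκ(-1 + ε w²)`. Each of the two
equations, in integrated form, holds on every subinterval on which `x` stays in the domain of the
respective chart. -/
structure IsTrajectory (κ : ℂ) (ε : ℝ → ℝ) (a b : ℝ) (x : ℝ → Sphere) : Prop where
  continuousOn : ContinuousOn x (Icc a b)
  eq_chart : ∀ c d : ℝ, a ≤ c → c ≤ d → d ≤ b → (∀ s ∈ Icc c d, x s ≠ OnePoint.infty) →
    chart (x d) - chart (x c) =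
      ∫ s in c..d, Complex.I * κ * (-(chart (x s)) ^ 2 + (ε s : ℂ))
  eq_chartInf : ∀ c d : ℝ, a ≤ c → c ≤ d → d ≤ b → (∀ s ∈ Icc c d, x s ≠ OnePoint.some 0) →
    chartInf (x d) - chartInf (x c) =
      ∫ s in c..d, Complex.I * κ * (-1 + (ε s : ℂ) * (chartInf (x s)) ^ 2)

/-- The control `ε`, started at time `sm`, steers the system from `ηm` to `ηp` in time `t`. -/
def Steers (κ : ℂ) (sm : ℝ) (ε : ℝ → ℝ) (ηm ηp : Sphere) (t : ℝ≥0) : Prop :=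
  ∃ x : ℝ → Sphere, IsTrajectory κ ε sm (sm + t) x ∧ x sm = ηm ∧ x (sm + t) = ηp

/-- The set of states that some feasible control steers to `ηp` in time exactly `t`. -/
def controllableAt (n₁ n₂ sm : ℝ) (ηp : Sphere) (κ : ℂ) (t : ℝ≥0) : Set Sphere :=
  {η | ∃ ε ∈ Feasible n₁ n₂ (Ioi sm), Steers κ sm ε η ηp t}

/-- The set of states that can be steered to `ηp` in some time in `[0, t)`; for `t = ∞` this is
the set of states controllable to `ηp`. -/
def controllableBefore (n₁ n₂ sm : ℝ) (ηp : Sphere) (κ : ℂ) (t : ℝ≥0∞) : Set Sphere :=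
  ⋃ (t₀ : ℝ≥0) (_ : (t₀ : ℝ≥0∞) < t), controllableAt n₁ n₂ sm ηp κ t₀

/-- The minimal time from `ηm` to `ηp`; it is `∞` if `ηm` is not controllable to `ηp`. -/
def Tmin (n₁ n₂ sm : ℝ) (κ : ℂ) (ηm ηp : Sphere) : ℝ≥0∞ :=
  ⨅ (t : ℝ≥0) (_ : ηm ∈ controllableAt n₁ n₂ sm ηp κ t), (t : ℝ≥0∞)

/-- The set of minimum-time controls from `ηm` to `ηp`. -/
def minTimeControls (n₁ n₂ sm : ℝ) (κ : ℂ) (ηm ηp : Sphere) : Set (Linf (Ioi sm)) :=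
  {ε | ε ∈ Feasible n₁ n₂ (Ioi sm) ∧
    ∃ t : ℝ≥0, (t : ℝ≥0∞) = Tmin n₁ n₂ sm κ ηm ηp ∧ Steers κ sm ε ηm ηp t}

/-- `y` is a `W^{2,∞}(a, b)` solution of `y'' = -κ² ε y` (for bounded `ε`) with derivative `dy`:
`y` is `C¹` and `dy` is a primitive of `-κ² ε y`. -/
structure IsSolution (κ : ℂ) (ε : ℝ → ℝ) (a b : ℝ) (y dy : ℝ → ℂ) : Prop where
  hasDeriv : ∀ s ∈ Icc a b, HasDerivWithinAt y (dy s) (Icc a b) s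
  eq_integral : ∀ s ∈ Icc a b, dy s = dy a + ∫ r in a..s, -κ ^ 2 * (ε r : ℂ) * y r

/-- The boundary condition `v / (iκ u) = η`, understood as `u = 0` when `η = ∞`. -/
def BoundaryCond (κ u v : ℂ) : Sphere → Prop
  | OnePoint.infty => u = 0
  | OnePoint.some z => u ≠ 0 ∧ v / (Complex.I * κ * u) = z

/-- The set of `(ηm, ηp)`-eigenvalues of `ε` on `(a, b)`. -/
def eigenvalues (a b : ℝ) (ηm ηp : Sphere) (ε : ℝ → ℝ) : Set ℂ :=
  {κ | κ ≠ 0 ∧ ∃ y dy : ℝ → ℂ, IsSolution κ ε a b y dy ∧ (∃ s ∈ Icc a b, y s ≠ 0) ∧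
    BoundaryCond κ (y a) (dy a) ηm ∧ BoundaryCond κ (y b) (dy b) ηp}

/-- The set of achievable `(ηm, ηp)`-eigenvalues over the feasible resonators on `(a, b)`. -/
def achievable (n₁ n₂ a b : ℝ) (ηm ηp : Sphere) : Set ℂ :=
  ⋃ ε ∈ Feasible n₁ n₂ (Ioo a b), eigenvalues a b ηm ηp ε

/-- The minimal modulus of an achievable eigenvalue with complex argument `γ` (and `∞` if there is
no such eigenvalue). -/
def rhoMin (n₁ n₂ a b : ℝ) (ηm ηp : Sphere) (γ : ℝ) : ℝ≥0∞ :=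
  ⨅ (κ : ℂ) (_ : κ ∈ achievable n₁ n₂ a b ηm ηp ∧ κ.arg = γ), ENNReal.ofReal ‖κ‖

/-- The set of resonators of minimal modulus for the complex argument `γ`. -/
def minModulusResonators (n₁ n₂ a b : ℝ) (ηm ηp : Sphere) (γ : ℝ) : Set (Linf (Ioo a b)) :=
  {ε | ε ∈ Feasible n₁ n₂ (Ioo a b) ∧ rhoMin n₁ n₂ a b ηm ηp γ ≠ ∞ ∧
    Complex.exp (Complex.I * γ) * ((rhoMin n₁ n₂ a b ηm ηp γ).toReal : ℂ) ∈
      eigenvalues a b ηm ηp ε}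

end Resonator

end

/-! Both problems are shadows of one linear system, y' = iκw, w' = iκ e y. Eliminating w gives y'' =
-κ² e y with w = y'/(iκ), so the boundary conditions say that the vector (y, w) lies on prescribed
complex lines at the two ends. Projecting (y, w) to the sphere as x = w/y gives the Riccati system
(R). Hence "e has eigenvalue κ" and "e steers" both mean that some nonvanishing solution starts on
the line of `ηm` and ends on the line of `ηp`; this is `Joins`, and the two translations are
`mem_eigenvalues_iff_of_ae` and `steers_iff_of_ae`. Projecting a solution is a quotient-rule
computation. Lifting a trajectory is harder (`IsTrajectory.joins`): in each chart an integrating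
factor recovers (y, w), and the pieces are glued after rescaling by constants.

The linear system is homogeneous in time: compressing an interval by a factor r > 0 multiplies κ by
r. Steering with κ in time t is therefore the same as having an eigenvalue of modulus t‖κ‖/(sp - sm)
on the ray through κ (`mem_controllableAt_iff_moduli`). So times and moduli are proportional, which
gives the formula for the minimal time and the equivalence of controllability with achievability.

The two minima exist by compactness (`Joins.of_tendsto`). Controls need not converge pointwise, but
their primitives and the solutions are uniformly Lipschitz, so Arzelà–Ascoli applies; after an
integration by parts the equation involves the control only through its primitive, and passes to the
limit. The limiting modulus is not 0, because at κ = 0 solutions are constant while `ηm ≠ ηp`.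

If the interval has length equal to the minimal time, the minimal modulus is ‖κ‖, the rescaling is
the identity, and the same coefficients solve both problems. -/

noncomputable section

namespace Resonator

open Filter Topology

/-! ### Calculus of Lipschitz functions with almost everywhere derivatives. -/

section Calculus

variable {E : Type*} [NormedAddCommGroup E] [NormedSpace ℝ E]

/-- `f` is Lipschitz on `[a, b]` and has the derivative `f'` almost everywhere there. -/
structure HasAEDeriv (f f' : ℝ → E) (a b : ℝ) : Prop where
  lipschitz : ∃ K, LipschitzOnWith K f (Icc a b)
  ae : ∀ᵐ s, s ∈ Ioo a b → HasDerivAt f (f' s) s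

namespace HasAEDeriv

variable {f f' g g' : ℝ → E} {a b c d : ℝ}

lemma continuousOn (h : HasAEDeriv f f' a b) : ContinuousOn f (Icc a b) := by
  obtain ⟨K, hK⟩ := h.lipschitz
  exact hK.continuousOn

lemma mono (h : HasAEDeriv f f' a b) (hac : a ≤ c) (hdb : d ≤ b) : HasAEDeriv f f' c d := by
  obtain ⟨K, hK⟩ := h.lipschitz
  refine ⟨⟨K, hK.mono (Icc_subset_Icc hac hdb)⟩, ?_⟩
  filter_upwards [h.ae] with s hs hcd
  exact hs (Ioo_subset_Ioo hac hdb hcd)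

lemma congr_left (h : HasAEDeriv f f' a b) (hfg : ∀ s ∈ Icc a b, g s = f s) :
    HasAEDeriv g f' a b := by
  obtain ⟨K, hK⟩ := h.lipschitz
  refine ⟨⟨K, fun s hs t ht => ?_⟩, ?_⟩
  · rw [hfg s hs, hfg t ht]; exact hK hs ht
  · filter_upwards [h.ae] with s hs hab
    refine (hs hab).congr_of_eventuallyEq ?_
    filter_upwards [Icc_mem_nhds hab.1 hab.2] with t ht using hfg t ht

lemma congr_right_ae (h : HasAEDeriv f f' a b) (hfg : ∀ᵐ s, s ∈ Ioo a b → g' s = f' s) :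
    HasAEDeriv f g' a b := by
  refine ⟨h.lipschitz, ?_⟩
  filter_upwards [h.ae, hfg] with s hs hs' hab
  rw [hs' hab]; exact hs hab

lemma congr_right (h : HasAEDeriv f f' a b) (hfg : ∀ s ∈ Ioo a b, g' s = f' s) :
    HasAEDeriv f g' a b :=
  h.congr_right_ae (Eventually.of_forall hfg)

lemma congr (h : HasAEDeriv f f' a b) (hf : ∀ s ∈ Icc a b, g s = f s)
    (hf' : ∀ s ∈ Ioo a b, g' s = f' s) : HasAEDeriv g g' a b :=
  (h.congr_left hf).congr_right hf'

lemma add (hf : HasAEDeriv f f' a b) (hg : HasAEDeriv g g' a b) :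
    HasAEDeriv (fun s => f s + g s) (fun s => f' s + g' s) a b := by
  obtain ⟨K, hK⟩ := hf.lipschitz
  obtain ⟨L, hL⟩ := hg.lipschitz
  refine ⟨⟨K + L, hK.add hL⟩, ?_⟩
  filter_upwards [hf.ae, hg.ae] with s h₁ h₂ hs using (h₁ hs).add (h₂ hs)

lemma neg (hf : HasAEDeriv f f' a b) : HasAEDeriv (fun s => -f s) (fun s => -f' s) a b := by
  obtain ⟨K, hK⟩ := hf.lipschitz
  refine ⟨⟨K, hK.neg⟩, ?_⟩
  filter_upwards [hf.ae] with s h₁ hs using (h₁ hs).neg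

lemma sub (hf : HasAEDeriv f f' a b) (hg : HasAEDeriv g g' a b) :
    HasAEDeriv (fun s => f s - g s) (fun s => f' s - g' s) a b := by
  simpa only [sub_eq_add_neg] using hf.add hg.neg

lemma const (v : E) : HasAEDeriv (fun _ => v) (fun _ => 0) a b :=
  ⟨⟨0, (LipschitzWith.const v).lipschitzOnWith⟩,
    Eventually.of_forall fun s _ => hasDerivAt_const s v⟩

lemma mul {A : Type*} [NormedRing A] [NormedAlgebra ℝ A] {f f' g g' : ℝ → A}
    (hf : HasAEDeriv f f' a b) (hg : HasAEDeriv g g' a b) :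
    HasAEDeriv (fun s => f s * g s) (fun s => f' s * g s + f s * g' s) a b := by
  obtain ⟨K, hK⟩ := hf.lipschitz
  obtain ⟨L, hL⟩ := hg.lipschitz
  obtain ⟨A, hA⟩ := isCompact_Icc.exists_bound_of_continuousOn hf.continuousOn
  obtain ⟨B, hB⟩ := isCompact_Icc.exists_bound_of_continuousOn hg.continuousOn
  refine ⟨⟨A.toNNReal * L + K * B.toNNReal, LipschitzOnWith.of_dist_le_mul ?_⟩, ?_⟩
  · intro s hs t ht
    have e : f s * g s - f t * g t = f s * (g s - g t) + (f s - f t) * g t := by noncomm_ring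
    have h₁ := hK.dist_le_mul s hs t ht
    have h₂ := hL.dist_le_mul s hs t ht
    rw [dist_eq_norm] at h₁ h₂ ⊢
    rw [e]
    have h₃ : ‖f s‖ ≤ A.toNNReal := (hA s hs).trans (Real.le_coe_toNNReal A)
    have h₄ : ‖g t‖ ≤ B.toNNReal := (hB t ht).trans (Real.le_coe_toNNReal B)
    calc _ ≤ ‖f s‖ * ‖g s - g t‖ + ‖f s - f t‖ * ‖g t‖ :=
          (norm_add_le _ _).trans (add_le_add (norm_mul_le _ _) (norm_mul_le _ _))
      _ ≤ A.toNNReal * (L * dist s t) + (K * dist s t) * B.toNNReal := by gcongr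
      _ = _ := by push_cast; ring
  · filter_upwards [hf.ae, hg.ae] with s h₁ h₂ hs using (h₁ hs).mul (h₂ hs)

lemma const_mul {A : Type*} [NormedRing A] [NormedAlgebra ℝ A] {f f' : ℝ → A} (v : A)
    (hf : HasAEDeriv f f' a b) : HasAEDeriv (fun s => v * f s) (fun s => v * f' s) a b :=
  ((const v).mul hf).congr (fun _ _ => rfl) (fun s _ => by simp)

lemma ofReal {f f' : ℝ → ℝ} (hf : HasAEDeriv f f' a b) :
    HasAEDeriv (fun s => (f s : ℂ)) (fun s => (f' s : ℂ)) a b := by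
  obtain ⟨K, hK⟩ := hf.lipschitz
  refine ⟨⟨1 * K, Complex.isometry_ofReal.lipschitz.comp_lipschitzOnWith hK⟩, ?_⟩
  filter_upwards [hf.ae] with s h₁ hs using (h₁ hs).ofReal_comp

/-- The Lipschitz bound on `F` is required only on a set containing the values of `f`, so that
functions such as `exp` and inversion, which are not globally Lipschitz, are covered. -/
lemma comp {F F' : ℂ → ℂ} {f f' : ℝ → ℂ} {S : Set ℂ} (hf : HasAEDeriv f f' a b)
    (hS : ∀ s ∈ Icc a b, f s ∈ S) (hF : ∃ K, LipschitzOnWith K F S)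
    (hF' : ∀ z ∈ S, HasDerivAt F (F' z) z) :
    HasAEDeriv (fun s => F (f s)) (fun s => F' (f s) * f' s) a b := by
  obtain ⟨K, hK⟩ := hf.lipschitz
  obtain ⟨L, hL⟩ := hF
  refine ⟨⟨L * K, hL.comp hK hS⟩, ?_⟩
  filter_upwards [hf.ae] with s h₁ hs
  exact (hF' _ (hS s (Ioo_subset_Icc_self hs))).comp s (h₁ hs)

lemma cexp {f f' : ℝ → ℂ} (hf : HasAEDeriv f f' a b) :
    HasAEDeriv (fun s => Complex.exp (f s)) (fun s => Complex.exp (f s) * f' s) a b := by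
  obtain ⟨B, hB⟩ := isCompact_Icc.exists_bound_of_continuousOn hf.continuousOn
  refine hf.comp (S := Metric.closedBall 0 B) (F := Complex.exp) (F' := Complex.exp)
    (fun s hs => by simpa using hB s hs) ?_ (fun z _ => Complex.hasDerivAt_exp z)
  refine ⟨(Real.exp B).toNNReal, (convex_closedBall 0 B).lipschitzOnWith_of_nnnorm_hasDerivWithin_le
    (fun z _ => (Complex.hasDerivAt_exp z).hasDerivWithinAt) fun z hz => ?_⟩
  rw [← NNReal.coe_le_coe, coe_nnnorm, Complex.norm_exp, Real.coe_toNNReal _ (Real.exp_pos _).le]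
  refine Real.exp_le_exp.2 (((le_abs_self _).trans (Complex.abs_re_le_norm z)).trans ?_)
  simpa using hz

lemma inv {f f' : ℝ → ℂ} (hf : HasAEDeriv f f' a b) (h0 : ∀ s ∈ Icc a b, f s ≠ 0) :
    HasAEDeriv (fun s => (f s)⁻¹) (fun s => -(f s ^ 2)⁻¹ * f' s) a b := by
  obtain ⟨B, hB⟩ := isCompact_Icc.exists_bound_of_continuousOn (hf.continuousOn.inv₀ h0)
  have hB' : ∀ s ∈ Icc a b, ‖(f s)⁻¹‖ ≤ B.toNNReal :=
    fun s hs => (hB s hs).trans (Real.le_coe_toNNReal B)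
  -- Compactness keeps `f` away from 0; where the inverse is bounded by `B`, inversion is Lipschitz
  -- with constant `B²`.
  refine hf.comp (S := {z | z ≠ 0 ∧ ‖z⁻¹‖ ≤ B.toNNReal}) (F := fun z => z⁻¹)
    (F' := fun z => -(z ^ 2)⁻¹) (fun s hs => ⟨h0 s hs, hB' s hs⟩) ?_
    (fun z hz => hasDerivAt_inv hz.1)
  refine ⟨B.toNNReal * B.toNNReal, LipschitzOnWith.of_dist_le_mul ?_⟩
  rintro z ⟨hz, hz'⟩ w ⟨hw, hw'⟩
  rw [dist_eq_norm, dist_eq_norm, inv_sub_inv hz hw, div_eq_mul_inv, mul_inv, norm_mul, norm_mul,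
    mul_comm, norm_sub_rev]
  push_cast
  gcongr

lemma norm_sq {f f' : ℝ → ℂ} (hf : HasAEDeriv f f' a b) :
    HasAEDeriv (fun s => ‖f s‖ ^ 2) (fun s => 2 * inner ℝ (f s) (f' s)) a b := by
  obtain ⟨K, hK⟩ := hf.lipschitz
  obtain ⟨B, hB⟩ := isCompact_Icc.exists_bound_of_continuousOn hf.continuousOn
  refine ⟨⟨2 * B.toNNReal * K, LipschitzOnWith.of_dist_le_mul ?_⟩, ?_⟩
  · intro s hs t ht
    have h₁ := hK.dist_le_mul s hs t ht
    have h₂ := (abs_norm_sub_norm_le (f s) (f t)).trans ((dist_eq_norm (f s) (f t)).ge.trans h₁)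
    have h₃ := (hB s hs).trans (Real.le_coe_toNNReal B)
    have h₄ := (hB t ht).trans (Real.le_coe_toNNReal B)
    rw [Real.dist_eq, sq_sub_sq, abs_mul, abs_of_nonneg (by positivity)]
    push_cast
    rw [mul_assoc (2 * _)]
    gcongr
    linarith
  · filter_upwards [hf.ae] with s h₁ hs using (h₁ hs).norm_sq

lemma ae_norm_le (h : HasAEDeriv f f' a b) : ∃ K, ∀ᵐ s, s ∈ Ioo a b → ‖f' s‖ ≤ K := by
  obtain ⟨K, hK⟩ := h.lipschitz
  refine ⟨K, ?_⟩
  filter_upwards [h.ae] with s hs hab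
  exact (hs hab).le_of_lipschitzOn (Icc_mem_nhds hab.1 hab.2) hK

/-- Measurability comes from agreement with `deriv f` almost everywhere, boundedness from the
Lipschitz constant. -/
lemma intervalIntegrable [CompleteSpace E] (hab : a ≤ b) (h : HasAEDeriv f f' a b) :
    IntervalIntegrable f' volume a b := by
  obtain ⟨K, hK⟩ := h.ae_norm_le
  rw [intervalIntegrable_iff_integrableOn_Ioo_of_le hab]
  have hm : AEStronglyMeasurable f' (volume.restrict (Ioo a b)) := by
    refine (stronglyMeasurable_deriv f).aestronglyMeasurable.congr ?_
    rw [EventuallyEq, ae_restrict_iff' measurableSet_Ioo]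
    filter_upwards [h.ae] with s hs hs' using (hs hs').deriv
  refine Integrable.of_bound hm K ?_
  rwa [ae_restrict_iff' measurableSet_Ioo]

/-- Lebesgue differentiation: this is how integral equations enter the calculus. -/
lemma of_integral [CompleteSpace E] (hab : a ≤ b) {K : ℝ} (hint : IntervalIntegrable f' volume a b)
    (hK : ∀ᵐ s, s ∈ Ioo a b → ‖f' s‖ ≤ K) (hf : ∀ s ∈ Icc a b, f s = f a + ∫ r in a..s, f' r) :
    HasAEDeriv f f' a b := by
  suffices HasAEDeriv (fun s => f a + ∫ r in a..s, f' r) f' a b from this.congr_left hf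
  have hK' : ∀ᵐ s, s ∈ Icc a b → ‖f' s‖ ≤ K := by
    have h₁ : ∀ᵐ s : ℝ, s ≠ a := by simp [ae_iff, measure_singleton]
    have h₂ : ∀ᵐ s : ℝ, s ≠ b := by simp [ae_iff, measure_singleton]
    filter_upwards [hK, h₁, h₂] with s hs h₁ h₂ h₃
    exact hs ⟨lt_of_le_of_ne h₃.1 h₁.symm, lt_of_le_of_ne h₃.2 h₂⟩
  refine ⟨⟨K.toNNReal, LipschitzOnWith.of_dist_le_mul fun s hs t ht => ?_⟩, ?_⟩
  · have hs' : s ∈ uIcc a b := by rwa [uIcc_of_le hab]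
    have ht' : t ∈ uIcc a b := by rwa [uIcc_of_le hab]
    have hi : ∀ u ∈ uIcc a b, IntervalIntegrable f' volume a u := fun u hu =>
      hint.mono_set (uIcc_subset_uIcc left_mem_uIcc hu)
    rw [dist_add_left, dist_eq_norm, intervalIntegral.integral_interval_sub_left (hi s hs')
      (hi t ht'), Real.dist_eq]
    refine intervalIntegral.norm_integral_le_of_norm_le_const_ae ?_
    filter_upwards [hK'] with r hr hr'
    refine (hr ?_).trans (Real.le_coe_toNNReal K)
    have := uIoc_subset_uIcc.trans (uIcc_subset_uIcc ht' hs') hr'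
    rwa [uIcc_of_le hab] at this
  · filter_upwards [hint.ae_hasDerivAt_integral] with s hs hs'
    rw [uIcc_of_le hab] at hs
    exact (hs (Ioo_subset_Icc_self hs') a (left_mem_Icc.2 hab)).const_add _

/-- The difference between `f` and the primitive of `f'` is Lipschitz, hence absolutely continuous,
and has derivative 0 almost everywhere; so it is constant. -/
lemma eq_integral [CompleteSpace E] (hab : a ≤ b) (h : HasAEDeriv f f' a b) :
    f b = f a + ∫ s in a..b, f' s := by
  have hi := h.intervalIntegrable hab
  obtain ⟨K, hK⟩ := h.ae_norm_le
  have hg : HasAEDeriv (fun s => f a + ∫ r in a..s, f' r) f' a b :=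
    of_integral hab hi hK fun s _ => by simp
  have hd := h.sub hg
  obtain ⟨L, hL⟩ := hd.lipschitz
  rw [← uIcc_of_le hab] at hL
  have h₁ : ∀ᵐ s : ℝ, s ≠ a := by simp [ae_iff, measure_singleton]
  have h₂ : ∀ᵐ s : ℝ, s ≠ b := by simp [ae_iff, measure_singleton]
  obtain ⟨C, hC⟩ := hL.absolutelyContinuousOnInterval.const_of_ae_hasDerivAt_zero (by
    filter_upwards [hd.ae, h₁, h₂] with s hs h₁ h₂ h₃
    rw [uIcc_of_le hab] at h₃
    simpa using hs ⟨lt_of_le_of_ne h₃.1 h₁.symm, lt_of_le_of_ne h₃.2 h₂⟩)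
  have ha := hC a left_mem_uIcc
  have hb := hC b right_mem_uIcc
  simp only [intervalIntegral.integral_same, add_zero, sub_self] at ha
  rw [← ha] at hb
  exact sub_eq_zero.1 hb

lemma eq_integral_of_le [CompleteSpace E] (h : HasAEDeriv f f' a b) (hac : a ≤ c) (hcd : c ≤ d)
    (hdb : d ≤ b) : f d = f c + ∫ s in c..d, f' s :=
  (h.mono hac hdb).eq_integral hcd

lemma of_continuousOn [CompleteSpace E] (hab : a ≤ b) (hc : ContinuousOn f' (Icc a b))
    (hf : ∀ s ∈ Icc a b, f s = f a + ∫ r in a..s, f' r) : HasAEDeriv f f' a b := by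
  obtain ⟨K, hK⟩ := isCompact_Icc.exists_bound_of_continuousOn hc
  exact of_integral hab (hc.intervalIntegrable_of_Icc hab) (K := K)
    (Eventually.of_forall fun s hs => hK s (Ioo_subset_Icc_self hs)) hf

/-- Gluing at a common value. -/
lemma glue (hac : a ≤ c) (hcb : c ≤ b) (hf : HasAEDeriv f f' a c) (hg : HasAEDeriv g g' c b)
    (hfg : f c = g c) :
    HasAEDeriv (fun s => if s ≤ c then f s else g s) (fun s => if s ≤ c then f' s else g' s)
      a b := by
  obtain ⟨K, hK⟩ := hf.lipschitz
  obtain ⟨L, hL⟩ := hg.lipschitz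
  refine ⟨⟨K + L, LipschitzOnWith.of_dist_le_mul ?_⟩, ?_⟩
  · have key : ∀ s ∈ Icc a b, ∀ t ∈ Icc a b, s ≤ t →
        dist (if s ≤ c then f s else g s) (if t ≤ c then f t else g t) ≤ (K + L) * dist s t := by
      intro s hs t ht hst
      have hd : dist s t = t - s := by rw [dist_comm, Real.dist_eq, abs_of_nonneg (by linarith)]
      rw [hd]
      by_cases htc : t ≤ c
      · rw [if_pos htc, if_pos (hst.trans htc)]
        refine (hK.dist_le_mul s ⟨hs.1, hst.trans htc⟩ t ⟨ht.1, htc⟩).trans ?_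
        rw [hd]
        exact mul_le_mul_of_nonneg_right (by simp) (by linarith)
      · rw [if_neg htc]
        push Not at htc
        by_cases hsc : s ≤ c
        · rw [if_pos hsc]
          have h₁ := hK.dist_le_mul s ⟨hs.1, hsc⟩ c ⟨hac, le_rfl⟩
          have h₂ := hL.dist_le_mul c ⟨le_rfl, hcb⟩ t ⟨htc.le, ht.2⟩
          rw [dist_comm s, Real.dist_eq, abs_of_nonneg (by linarith)] at h₁
          rw [dist_comm c, Real.dist_eq, abs_of_nonneg (by linarith)] at h₂
          rw [← hfg] at h₂
          refine (dist_triangle _ _ _).trans ((add_le_add h₁ h₂).trans ?_)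
          nlinarith [K.coe_nonneg, L.coe_nonneg]
        · rw [if_neg hsc]
          push Not at hsc
          refine (hL.dist_le_mul s ⟨hsc.le, hs.2⟩ t ⟨htc.le, ht.2⟩).trans ?_
          rw [hd]
          exact mul_le_mul_of_nonneg_right (by simp) (by linarith)
    intro s hs t ht
    push_cast
    rcases le_total s t with h | h
    · exact key s hs t ht h
    · rw [dist_comm, dist_comm s]; exact key t ht s hs h
  · have h₁ : ∀ᵐ s : ℝ, s ≠ c := by simp [ae_iff, measure_singleton]
    filter_upwards [hf.ae, hg.ae, h₁] with s h₁ h₂ h₃ hs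
    rcases lt_or_gt_of_ne h₃ with h | h
    · rw [if_pos h.le]
      refine (h₁ ⟨hs.1, h⟩).congr_of_eventuallyEq ?_
      filter_upwards [Iio_mem_nhds h] with t ht using if_pos (le_of_lt ht)
    · rw [if_neg h.not_ge]
      refine (h₂ ⟨h, hs.2⟩).congr_of_eventuallyEq ?_
      filter_upwards [Ioi_mem_nhds h] with t ht using if_neg (not_le_of_gt ht)

/-- The affine map `s ↦ p + r (s - a)` pulls back a derivative. -/
lemma comp_affine {p q r : ℝ} (hr : 0 < r) (hq : q = p + r * (b - a)) (hf : HasAEDeriv f f' p q) :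
    HasAEDeriv (fun s => f (p + r * (s - a))) (fun s => r • f' (p + r * (s - a))) a b := by
  obtain ⟨K, hK⟩ := hf.lipschitz
  refine ⟨⟨K * r.toNNReal, LipschitzOnWith.of_dist_le_mul fun s hs t ht => ?_⟩, ?_⟩
  · have hm : ∀ u ∈ Icc a b, p + r * (u - a) ∈ Icc p q := fun u hu =>
      ⟨by nlinarith [hu.1], by rw [hq]; nlinarith [hu.2]⟩
    refine (hK.dist_le_mul _ (hm s hs) _ (hm t ht)).trans (le_of_eq ?_)
    rw [Real.dist_eq, Real.dist_eq, show p + r * (s - a) - (p + r * (t - a)) = r * (s - t) by ring,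
      abs_mul, abs_of_pos hr]
    push_cast
    rw [Real.coe_toNNReal _ hr.le]; ring
  -- Null sets must have null preimages under the affine map for the a.e. derivative to be pulled
  -- back.
  · have hmap : Measure.QuasiMeasurePreserving (fun s : ℝ => p + r * (s - a)) volume volume := by
      have h₁ := (measurePreserving_sub_right volume a).quasiMeasurePreserving
      have h₂ := (measurePreserving_add_left volume p).quasiMeasurePreserving
      have h₃ : Measure.QuasiMeasurePreserving (fun s : ℝ => r * s) volume volume := by
        refine ⟨measurable_const_mul r, ?_⟩
        rw [Real.map_volume_mul_left hr.ne']
        exact Measure.smul_absolutelyContinuous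
      exact h₂.comp (h₃.comp h₁)
    filter_upwards [hmap.ae hf.ae] with s hs hab
    have hd : HasDerivAt (fun s : ℝ => p + r * (s - a)) r s := by
      simpa using (((hasDerivAt_id s).sub_const a).const_mul r).const_add p
    refine (hs ⟨?_, ?_⟩).scomp s hd
    · nlinarith [hab.1]
    · rw [hq]; nlinarith [hab.2]

end HasAEDeriv

end Calculus

/-! ### Continuous derivatives and Grönwall estimates. -/

namespace HasAEDeriv

variable {a b : ℝ}

lemma of_hasDerivWithinAt {E : Type*} [NormedAddCommGroup E] [NormedSpace ℝ E] {f f' : ℝ → E}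
    (hf : ∀ s ∈ Icc a b, HasDerivWithinAt f (f' s) (Icc a b) s)
    (hc : ContinuousOn f' (Icc a b)) : HasAEDeriv f f' a b := by
  obtain ⟨K, hK⟩ := isCompact_Icc.exists_bound_of_continuousOn hc
  refine ⟨⟨K.toNNReal, (convex_Icc a b).lipschitzOnWith_of_nnnorm_hasDerivWithin_le hf
    fun s hs => ?_⟩, Eventually.of_forall fun s hs => ?_⟩
  · rw [← NNReal.coe_le_coe, coe_nnnorm]
    exact (hK s hs).trans (Real.le_coe_toNNReal K)
  · exact (hf s (Ioo_subset_Icc_self hs)).hasDerivAt (Icc_mem_nhds hs.1 hs.2)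

lemma hasDerivWithinAt {f f' : ℝ → ℂ} (hab : a ≤ b) (hf : HasAEDeriv f f' a b)
    (hc : ContinuousOn f' (Icc a b)) {s : ℝ} (hs : s ∈ Icc a b) :
    HasDerivWithinAt f (f' s) (Icc a b) s := by
  -- Extending `f'` by constants beyond the interval makes its primitive differentiable on both
  -- sides, also at the endpoints.
  set F : ℝ → ℂ := IccExtend hab ((Icc a b).domRestrict f') with hF
  have hFc : Continuous F := (continuousOn_iff_continuous_domRestrict.1 hc).Icc_extend'
  have hFe : ∀ r ∈ Icc a b, F r = f' r := fun r hr => by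
    rw [hF, IccExtend_of_mem _ _ hr]; rfl
  have hd : HasDerivAt (fun s => f a + ∫ r in a..s, F r) (F s) s :=
    (hFc.integral_hasStrictDerivAt a s).hasDerivAt.const_add _
  rw [← hFe s hs]
  refine hd.hasDerivWithinAt.congr_of_mem (fun t ht => ?_) hs
  rw [hf.eq_integral_of_le le_rfl ht.1 ht.2]
  congr 1
  refine intervalIntegral.integral_congr fun r hr => ?_
  rw [uIcc_of_le ht.1] at hr
  exact (hFe r ⟨hr.1, hr.2.trans ht.2⟩).symm

lemma of_contDiff {f : ℝ → ℝ} (hf : ContDiff ℝ 1 f) : HasAEDeriv f (deriv f) a b := by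
  obtain ⟨K, hK⟩ := hf.contDiffOn.exists_lipschitzOnWith (by decide) (convex_Icc a b)
    isCompact_Icc
  exact ⟨⟨K, hK⟩, Eventually.of_forall fun s _ =>
    (hf.differentiable (by decide) s).hasDerivAt⟩

lemma exp_const_mul (C : ℝ) :
    HasAEDeriv (fun s => Real.exp (C * s)) (fun s => C * Real.exp (C * s)) a b :=
  (of_contDiff (by fun_prop)).congr_right fun s _ => by
    have h := ((hasDerivAt_id s).const_mul C).exp
    simpa [mul_comm] using h.deriv.symm

/-- Grönwall: the function N(s) exp(-Cs) has nonpositive derivative. -/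
lemma le_exp_mul {N N' : ℝ → ℝ} {C : ℝ} (hab : a ≤ b) (hN : HasAEDeriv N N' a b)
    (hC : ∀ᵐ s, s ∈ Ioo a b → N' s ≤ C * N s) : N b ≤ N a * Real.exp (C * (b - a)) := by
  have h := (hN.mul (exp_const_mul (-C))).eq_integral hab
  have hneg : ∫ s in a..b, (N' s * Real.exp (-C * s) + N s * (-C * Real.exp (-C * s))) ≤ 0 := by
    rw [intervalIntegral.integral_of_le hab, integral_Ioc_eq_integral_Ioo]
    refine integral_nonpos_of_ae ?_
    rw [EventuallyLE, ae_restrict_iff' measurableSet_Ioo]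
    filter_upwards [hC] with s hs hs'
    have := mul_nonneg (sub_nonneg.2 (hs hs')) (Real.exp_pos (-C * s)).le
    simp only [Pi.zero_apply]
    nlinarith
  have h₂ : N b * Real.exp (-C * b) ≤ N a * Real.exp (-C * a) := by linarith
  have h₃ := mul_le_mul_of_nonneg_right h₂ (Real.exp_pos (C * b)).le
  rw [mul_assoc, mul_assoc, ← Real.exp_add, ← Real.exp_add] at h₃
  have e₁ : -C * b + C * b = 0 := by ring
  have e₂ : -C * a + C * b = C * (b - a) := by ring
  rwa [e₁, e₂, Real.exp_zero, mul_one] at h₃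

/-- Backward Grönwall, from the forward form applied to -N and -C. It controls the past of a
solution by its future. -/
lemma le_exp_mul' {N N' : ℝ → ℝ} {C : ℝ} (hab : a ≤ b) (hN : HasAEDeriv N N' a b)
    (hC : ∀ᵐ s, s ∈ Ioo a b → -(C * N s) ≤ N' s) : N a ≤ N b * Real.exp (C * (b - a)) := by
  have h := le_exp_mul (C := -C) hab hN.neg (by
    filter_upwards [hC] with s hs hs'
    linarith [hs hs'])
  have h₃ := mul_le_mul_of_nonneg_right h (Real.exp_pos (C * (b - a))).le
  rw [mul_assoc, ← Real.exp_add] at h₃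
  have e₁ : -C * (b - a) + C * (b - a) = 0 := by ring
  rw [e₁, Real.exp_zero] at h₃
  linarith

end HasAEDeriv

/-! ### The linear first order system. -/

/-- The first order system `y' = iκ w`, `w' = iκ e y`, which is equivalent to `y'' = -κ² e y`. -/
structure LinSol (κ : ℂ) (e : ℝ → ℝ) (a b : ℝ) (y w : ℝ → ℂ) : Prop where
  left : HasAEDeriv y (fun s => Complex.I * κ * w s) a b
  right : HasAEDeriv w (fun s => Complex.I * κ * ((e s : ℂ) * y s)) a b

namespace LinSol

variable {κ : ℂ} {e : ℝ → ℝ} {a b c d M : ℝ} {y w : ℝ → ℂ}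

lemma mono (h : LinSol κ e a b y w) (hac : a ≤ c) (hdb : d ≤ b) : LinSol κ e c d y w :=
  ⟨h.left.mono hac hdb, h.right.mono hac hdb⟩

lemma const_mul (h : LinSol κ e a b y w) (v : ℂ) :
    LinSol κ e a b (fun s => v * y s) (fun s => v * w s) :=
  ⟨(h.left.const_mul v).congr_right fun s _ => by ring,
    (h.right.const_mul v).congr_right fun s _ => by ring⟩

lemma comp_affine {p q r : ℝ} (hr : 0 < r) (hq : q = p + r * (b - a)) (h : LinSol κ e p q y w) :
    LinSol (r * κ) (fun s => e (p + r * (s - a))) a b (fun s => y (p + r * (s - a)))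
      (fun s => w (p + r * (s - a))) :=
  ⟨(h.left.comp_affine hr hq).congr_right fun s _ => by rw [Complex.real_smul]; ring,
    (h.right.comp_affine hr hq).congr_right fun s _ => by rw [Complex.real_smul]; ring⟩

/-- The left side is the derivative of ‖y‖² + ‖w‖² along a solution. Cauchy–Schwarz and 2‖u‖‖v‖ ≤
‖u‖² + ‖v‖² give the differential inequality that both Grönwall estimates need. -/
lemma abs_normSq_deriv_le {κ u v : ℂ} {t M : ℝ} (ht : |t| ≤ M) :
    |2 * inner ℝ u (Complex.I * κ * v) + 2 * inner ℝ v (Complex.I * κ * ((t : ℂ) * u))| ≤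
      ‖κ‖ * (1 + M) * (‖u‖ ^ 2 + ‖v‖ ^ 2) := by
  have h₁ := abs_real_inner_le_norm u (Complex.I * κ * v)
  have h₂ := abs_real_inner_le_norm v (Complex.I * κ * ((t : ℂ) * u))
  simp only [norm_mul, Complex.norm_I, one_mul, Complex.norm_real, Real.norm_eq_abs] at h₁ h₂
  have h₃ : ‖v‖ * (‖κ‖ * (|t| * ‖u‖)) ≤ ‖v‖ * (‖κ‖ * (M * ‖u‖)) := by gcongr
  have hM : 0 ≤ M := (abs_nonneg t).trans ht
  have h₄ : 0 ≤ ‖κ‖ * (1 + M) * (‖u‖ - ‖v‖) ^ 2 := by positivity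
  refine (abs_add_le _ _).trans ?_
  rw [abs_mul, abs_mul, abs_two]
  nlinarith

lemma normSq_le (h : LinSol κ e a b y w) (he : ∀ s, |e s| ≤ M) (hab : a ≤ b) :
    ‖y b‖ ^ 2 + ‖w b‖ ^ 2 ≤ (‖y a‖ ^ 2 + ‖w a‖ ^ 2) * Real.exp (‖κ‖ * (1 + M) * (b - a)) :=
  (h.left.norm_sq.add h.right.norm_sq).le_exp_mul hab
    (Eventually.of_forall fun s _ => (abs_le.1 (abs_normSq_deriv_le (he s))).2)

lemma normSq_le' (h : LinSol κ e a b y w) (he : ∀ s, |e s| ≤ M) (hab : a ≤ b) :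
    ‖y a‖ ^ 2 + ‖w a‖ ^ 2 ≤ (‖y b‖ ^ 2 + ‖w b‖ ^ 2) * Real.exp (‖κ‖ * (1 + M) * (b - a)) :=
  (h.left.norm_sq.add h.right.norm_sq).le_exp_mul' hab
    (Eventually.of_forall fun s _ => (abs_le.1 (abs_normSq_deriv_le (he s))).1)

lemma eq_zero_iff {u v : ℂ} : ‖u‖ ^ 2 + ‖v‖ ^ 2 ≤ 0 ↔ u = 0 ∧ v = 0 := by
  constructor
  · intro h
    have h₁ : ‖u‖ ^ 2 = 0 := by nlinarith [sq_nonneg ‖u‖, sq_nonneg ‖v‖]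
    have h₂ : ‖v‖ ^ 2 = 0 := by nlinarith [sq_nonneg ‖u‖, sq_nonneg ‖v‖]
    simpa using And.intro h₁ h₂
  · rintro ⟨rfl, rfl⟩; simp

/-- A solution that vanishes at one point vanishes identically. -/
lemma eq_zero_of_eq_zero (h : LinSol κ e a b y w) (he : ∀ s, |e s| ≤ M) {s t : ℝ}
    (hs : s ∈ Icc a b) (ht : t ∈ Icc a b) (h0 : y s = 0 ∧ w s = 0) : y t = 0 ∧ w t = 0 := by
  rw [← eq_zero_iff]
  rcases le_total s t with hst | hst
  · simpa [h0.1, h0.2] using (h.mono hs.1 ht.2).normSq_le he hst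
  · simpa [h0.1, h0.2] using (h.mono ht.1 hs.2).normSq_le' he hst

end LinSol

/-! ### Homogeneous coordinates on the sphere. -/

/-- The point `v / u` of the Riemann sphere with homogeneous coordinates `(u, v)`. -/
def proj (u v : ℂ) : Sphere := if u = 0 then OnePoint.infty else OnePoint.some (v / u)

/-- The nonzero vectors with `proj u v = η` are the nonzero vectors of a complex line. -/
def OnLine (u v : ℂ) : Sphere → Prop
  | OnePoint.infty => u = 0
  | OnePoint.some z => v = z * u

lemma proj_eq_iff {u v : ℂ} (h : ¬ (u = 0 ∧ v = 0)) (η : Sphere) :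
    proj u v = η ↔ OnLine u v η := by
  unfold proj
  induction η using OnePoint.rec with
  | infty =>
    by_cases hu : u = 0 <;> simp [hu, OnLine]
  | coe z =>
    by_cases hu : u = 0
    · have hv : v ≠ 0 := fun hv => h ⟨hu, hv⟩
      simp [hu, OnLine, hv]
    · simp only [hu, if_false, OnLine]
      rw [← div_eq_iff hu]
      exact OnePoint.coe_eq_coe

/-- With y' = iκw the factor iκ cancels, and the boundary condition depends only on the line through
(y, w). -/
lemma boundaryCond_iff {κ u v : ℂ} (hκ : κ ≠ 0) (h : ¬ (u = 0 ∧ v = 0)) (η : Sphere) :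
    BoundaryCond κ u (Complex.I * κ * v) η ↔ proj u v = η := by
  rw [proj_eq_iff h]
  induction η using OnePoint.rec with
  | infty => rfl
  | coe z =>
    change (u ≠ 0 ∧ Complex.I * κ * v / (Complex.I * κ * u) = z) ↔ v = z * u
    rw [mul_div_mul_left _ _ (mul_ne_zero Complex.I_ne_zero hκ)]
    constructor
    · rintro ⟨hu, hz⟩; exact (div_eq_iff hu).1 hz
    · intro hz
      have hu : u ≠ 0 := by rintro rfl; exact h ⟨rfl, by simpa using hz⟩
      exact ⟨hu, (div_eq_iff hu).2 hz⟩

/-- Lets the terminal condition pass to limits of solutions. -/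
lemma isClosed_onLine (η : Sphere) : IsClosed {p : ℂ × ℂ | OnLine p.1 p.2 η} := by
  induction η using OnePoint.rec with
  | infty => exact isClosed_eq continuous_fst continuous_const
  | coe z => exact isClosed_eq continuous_snd (continuous_const.mul continuous_fst)

/-- A standard vector on the line. -/
lemma exists_rep (η : Sphere) : ∃ u₀ v₀ : ℂ, ¬ (u₀ = 0 ∧ v₀ = 0) ∧ OnLine u₀ v₀ η ∧
    ∀ u v : ℂ, ¬ (u = 0 ∧ v = 0) → OnLine u v η → ∃ l : ℂ, l ≠ 0 ∧ l * u = u₀ ∧ l * v = v₀ := by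
  induction η using OnePoint.rec with
  | infty =>
    refine ⟨0, 1, by simp, rfl, fun u v h hu => ?_⟩
    have hu : u = 0 := hu
    have hv : v ≠ 0 := fun hv => h ⟨hu, hv⟩
    exact ⟨v⁻¹, inv_ne_zero hv, by simp [hu], inv_mul_cancel₀ hv⟩
  | coe z =>
    refine ⟨1, z, by simp, (mul_one z).symm, fun u v h huv => ?_⟩
    have huv : v = z * u := huv
    have hu : u ≠ 0 := by rintro rfl; exact h ⟨rfl, by simpa using huv⟩
    exact ⟨u⁻¹, inv_ne_zero hu, inv_mul_cancel₀ hu, by rw [huv]; field_simp⟩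

lemma exists_mul_eq {η : Sphere} {u v u' v' : ℂ} (h : ¬ (u = 0 ∧ v = 0)) (h' : ¬ (u' = 0 ∧ v' = 0))
    (hη : OnLine u v η) (hη' : OnLine u' v' η) : ∃ l : ℂ, l ≠ 0 ∧ l * u = u' ∧ l * v = v' := by
  obtain ⟨u₀, v₀, -, -, H⟩ := exists_rep η
  obtain ⟨l, hl, h₁, h₂⟩ := H u v h hη
  obtain ⟨m, hm, h₃, h₄⟩ := H u' v' h' hη'
  refine ⟨m⁻¹ * l, mul_ne_zero (inv_ne_zero hm) hl, ?_, ?_⟩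
  · rw [mul_assoc, h₁, ← h₃, inv_mul_cancel_left₀ hm]
  · rw [mul_assoc, h₂, ← h₄, inv_mul_cancel_left₀ hm]

/-- A solution of the first order system whose projection to the sphere joins `ηm` to `ηp`. -/
def Joins (κ : ℂ) (e : ℝ → ℝ) (a b : ℝ) (ηm ηp : Sphere) : Prop :=
  ∃ y w : ℝ → ℂ, LinSol κ e a b y w ∧ ¬ (y a = 0 ∧ w a = 0) ∧ ¬ (y b = 0 ∧ w b = 0) ∧
    OnLine (y a) (w a) ηm ∧ OnLine (y b) (w b) ηp

/-! ### Eigenvalues as two-point problems for the linear system. -/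

section Eigenvalues

variable {κ : ℂ} {e : ℝ → ℝ} {a b M : ℝ} {y w dy : ℝ → ℂ} {ηm ηp : Sphere}

lemma LinSol.isSolution (hab : a ≤ b) (h : LinSol κ e a b y w) :
    IsSolution κ e a b y (fun s => Complex.I * κ * w s) := by
  refine ⟨fun s hs => h.left.hasDerivWithinAt hab
    (continuousOn_const.mul h.right.continuousOn) hs, fun s hs => ?_⟩
  rw [(h.right.const_mul (Complex.I * κ)).eq_integral_of_le le_rfl hs.1 hs.2]
  congr 1
  refine intervalIntegral.integral_congr fun r _ => ?_
  linear_combination (κ ^ 2 * (e r : ℂ) * y r) * Complex.I_sq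

lemma IsSolution.linSol (hκ : κ ≠ 0) (hab : a ≤ b) (hm : Measurable e) (he : ∀ s, |e s| ≤ M)
    (h : IsSolution κ e a b y dy) :
    LinSol κ e a b y (fun s => (Complex.I * κ)⁻¹ * dy s) := by
  have hyc : ContinuousOn y (Icc a b) := fun s hs => (h.hasDeriv s hs).continuousWithinAt
  obtain ⟨B, hB⟩ := isCompact_Icc.exists_bound_of_continuousOn hyc
  have hIκ : Complex.I * κ ≠ 0 := mul_ne_zero Complex.I_ne_zero hκ
  have hbd : ∀ s ∈ Icc a b, ‖-κ ^ 2 * (e s : ℂ) * y s‖ ≤ ‖κ‖ ^ 2 * M * B := fun s hs => by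
    rw [norm_mul, norm_mul, norm_neg, norm_pow, Complex.norm_real]
    have := he s
    have := hB s hs
    have := (abs_nonneg _).trans (he s)
    rw [Real.norm_eq_abs]
    gcongr
  have hint : IntervalIntegrable (fun r => -κ ^ 2 * (e r : ℂ) * y r) volume a b := by
    rw [intervalIntegrable_iff_integrableOn_Icc_of_le hab]
    have hmeas : AEStronglyMeasurable (fun r => -κ ^ 2 * (e r : ℂ) * y r)
        (volume.restrict (Icc a b)) :=
      ((measurable_const.mul (Complex.measurable_ofReal.comp hm)).aestronglyMeasurable).mul
        (hyc.aestronglyMeasurable measurableSet_Icc)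
    refine Integrable.of_bound hmeas (‖κ‖ ^ 2 * M * B) ?_
    rw [ae_restrict_iff' measurableSet_Icc]
    exact Eventually.of_forall hbd
  have hdy : HasAEDeriv dy (fun r => -κ ^ 2 * (e r : ℂ) * y r) a b :=
    HasAEDeriv.of_integral hab hint
      (Eventually.of_forall fun s hs => hbd s (Ioo_subset_Icc_self hs)) h.eq_integral
  refine ⟨(HasAEDeriv.of_hasDerivWithinAt h.hasDeriv hdy.continuousOn).congr_right fun s _ => ?_,
    (hdy.const_mul _).congr_right fun s _ => ?_⟩
  · rw [mul_inv_cancel_left₀ hIκ]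
  · field_simp
    linear_combination ((e s : ℂ) * y s) * Complex.I_sq

lemma mem_eigenvalues_iff (hκ : κ ≠ 0) (hab : a < b) (hm : Measurable e)
    (he : ∀ s, |e s| ≤ M) : κ ∈ eigenvalues a b ηm ηp e ↔ Joins κ e a b ηm ηp := by
  have ha : a ∈ Icc a b := left_mem_Icc.2 hab.le
  have hb : b ∈ Icc a b := right_mem_Icc.2 hab.le
  have hIκ : Complex.I * κ ≠ 0 := mul_ne_zero Complex.I_ne_zero hκ
  constructor
  · rintro ⟨-, y, dy, h, ⟨s, hs, hys⟩, hm', hp'⟩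
    have hL := h.linSol hκ hab.le hm he
    have hdy : ∀ t, dy t = Complex.I * κ * ((Complex.I * κ)⁻¹ * dy t) := fun t =>
      (mul_inv_cancel_left₀ hIκ _).symm
    have hne : ∀ t ∈ Icc a b, ¬ (y t = 0 ∧ (Complex.I * κ)⁻¹ * dy t = 0) := fun t ht h0 =>
      hys (hL.eq_zero_of_eq_zero he ht hs h0).1
    rw [hdy a, boundaryCond_iff hκ (hne a ha), proj_eq_iff (hne a ha)] at hm'
    rw [hdy b, boundaryCond_iff hκ (hne b hb), proj_eq_iff (hne b hb)] at hp'
    exact ⟨y, _, hL, hne a ha, hne b hb, hm', hp'⟩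
  · rintro ⟨y, w, h, hna, hnb, hm', hp'⟩
    have hS := h.isSolution hab.le
    refine ⟨hκ, y, _, hS, ?_, ?_, ?_⟩
    -- If y vanished identically, its one-sided derivative at `a` would vanish too, so (y, w) would
    -- be zero at `a`.
    · by_contra! h0
      refine hna ⟨h0 a ha, ?_⟩
      have h₁ : HasDerivWithinAt y 0 (Icc a b) a :=
        (hasDerivWithinAt_const a (Icc a b) (0 : ℂ)).congr_of_mem h0 ha
      have := (uniqueDiffOn_Icc hab a ha).eq_deriv _ (hS.hasDeriv a ha) h₁
      exact (mul_eq_zero.1 this).resolve_left hIκ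
    · rw [boundaryCond_iff hκ hna, proj_eq_iff hna]; exact hm'
    · rw [boundaryCond_iff hκ hnb, proj_eq_iff hnb]; exact hp'

end Eigenvalues

/-! ### Charts of the sphere and continuity of the projection. -/

lemma chart_proj {u v : ℂ} (hu : u ≠ 0) : chart (proj u v) = v / u := by
  rw [proj, if_neg hu]; rfl

lemma chartInf_proj (u v : ℂ) : chartInf (proj u v) = -(u / v) := by
  by_cases hu : u = 0
  · rw [proj, if_pos hu, hu]; simp [chartInf]
  · rw [proj, if_neg hu]
    change -(v / u)⁻¹ = _
    rw [inv_div]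

lemma proj_eq_infty {u v : ℂ} : proj u v = OnePoint.infty ↔ u = 0 := by
  unfold proj
  by_cases hu : u = 0 <;> simp [hu]

lemma proj_eq_zero {u v : ℂ} (hv : v = 0) (hu : u ≠ 0) : proj u v = OnePoint.some 0 := by
  rw [proj, if_neg hu, hv, zero_div]

lemma continuousAt_proj {p : ℂ × ℂ} (hp : ¬ (p.1 = 0 ∧ p.2 = 0)) :
    ContinuousAt (fun p : ℂ × ℂ => proj p.1 p.2) p := by
  by_cases hu : p.1 = 0
  · have hv : p.2 ≠ 0 := fun hv => hp ⟨hu, hv⟩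
    change Tendsto _ _ (𝓝 (proj p.1 p.2))
    rw [show proj p.1 p.2 = OnePoint.infty from proj_eq_infty.2 hu]
    refine OnePoint.hasBasis_nhds_infty.tendsto_right_iff.2 ?_
    rintro K ⟨-, hK⟩
    obtain ⟨R, hR⟩ := hK.isBounded.exists_norm_le
    have hlt : R * ‖p.1‖ < ‖p.2‖ := by rw [hu]; simpa using hv
    -- Near a point with u = 0 and v ≠ 0 the quotient v/u leaves every disc; writing this as R‖u‖ <
    -- ‖v‖ avoids dividing by 0.
    have hcont : ∀ᶠ q : ℂ × ℂ in 𝓝 p, R * ‖q.1‖ < ‖q.2‖ :=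
      ContinuousAt.eventually_lt (by fun_prop) (by fun_prop) hlt
    filter_upwards [hcont] with q hq
    by_cases hq1 : q.1 = 0
    · exact Or.inr (proj_eq_infty.2 hq1)
    · refine Or.inl ⟨q.2 / q.1, fun hmem => ?_, (if_neg hq1).symm⟩
      have h₁ := hR _ hmem
      rw [norm_div, div_le_iff₀ (norm_pos_iff.2 hq1)] at h₁
      linarith
  · have h₁ : ContinuousAt (fun q : ℂ × ℂ => ((q.2 / q.1 : ℂ) : OnePoint ℂ)) p :=
      OnePoint.continuous_coe.continuousAt.comp
        (continuousAt_snd.div continuousAt_fst hu)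
    refine h₁.congr ?_
    filter_upwards [continuousAt_fst.eventually_ne hu] with q hq
    exact (if_neg hq).symm

lemma continuousAt_chart {x : Sphere} (hx : x ≠ OnePoint.infty) : ContinuousAt chart x := by
  induction x using OnePoint.rec with
  | infty => exact absurd rfl hx
  | coe z => exact OnePoint.continuousAt_coe.2 continuousAt_id

lemma continuousAt_chartInf {x : Sphere} (hx : x ≠ OnePoint.some 0) :
    ContinuousAt chartInf x := by
  induction x using OnePoint.rec with
  | infty =>
    rw [OnePoint.continuousAt_infty']
    have h : Tendsto (fun z : ℂ => -z⁻¹) (Bornology.cobounded ℂ) (𝓝 (-0)) :=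
      (tendsto_inv₀_cobounded (α := ℂ)).neg
    rw [neg_zero, Metric.cobounded_eq_cocompact] at h
    rw [coclosedCompact_eq_cocompact]
    exact h
  | coe z =>
    have hz : z ≠ 0 := fun h => hx (by rw [h])
    exact OnePoint.continuousAt_coe.2 (continuousAt_inv₀ hz).neg

/-! ### Riccati trajectories and their lifts. -/

section Trajectories

variable {κ : ℂ} {e : ℝ → ℝ} {a b c d M : ℝ} {y w : ℝ → ℂ} {x : ℝ → Sphere}

/-- The Riccati equation satisfied by the quotient of the components of a solution. -/
lemma LinSol.isTrajectory (h : LinSol κ e a b y w)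
    (hne : ∀ s ∈ Icc a b, ¬ (y s = 0 ∧ w s = 0)) :
    IsTrajectory κ e a b (fun s => proj (y s) (w s)) := by
  refine ⟨fun s hs => ?_, fun c d hac hcd hdb hx => ?_, fun c d hac hcd hdb hx => ?_⟩
  · exact (continuousAt_proj (p := (y s, w s)) (hne s hs)).comp_continuousWithinAt
      (f := fun s => (y s, w s)) ((h.left.continuousOn s hs).prodMk (h.right.continuousOn s hs))
  · have h' := h.mono hac hdb
    have hy : ∀ s ∈ Icc c d, y s ≠ 0 := fun s hs h0 => hx s hs (proj_eq_infty.2 h0)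
    have hq : HasAEDeriv (fun s => chart (proj (y s) (w s)))
        (fun s => Complex.I * κ * (-(chart (proj (y s) (w s))) ^ 2 + (e s : ℂ))) c d := by
      refine (h'.right.mul (h'.left.inv hy)).congr (fun s hs => ?_) (fun s hs => ?_)
      · rw [chart_proj (hy s hs), div_eq_mul_inv]
      · have := hy s (Ioo_subset_Icc_self hs)
        rw [chart_proj this]
        field_simp
        ring
    rw [hq.eq_integral hcd, add_sub_cancel_left]
  · have h' := h.mono hac hdb
    have hw : ∀ s ∈ Icc c d, w s ≠ 0 := fun s hs h0 => hx s hs (proj_eq_zero h0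
      fun h0' => hne s ⟨hac.trans hs.1, hs.2.trans hdb⟩ ⟨h0', h0⟩)
    have hq : HasAEDeriv (fun s => chartInf (proj (y s) (w s)))
        (fun s => Complex.I * κ * (-1 + (e s : ℂ) * (chartInf (proj (y s) (w s))) ^ 2)) c d := by
      refine (h'.left.mul (h'.right.inv hw)).neg.congr (fun s hs => ?_) (fun s hs => ?_)
      · rw [chartInf_proj, div_eq_mul_inv]
      · have := hw s (Ioo_subset_Icc_self hs)
        rw [chartInf_proj]
        field_simp
        ring
    rw [hq.eq_integral hcd, add_sub_cancel_left]

lemma Joins.exists_isTrajectory {ηm ηp : Sphere} (hab : a ≤ b) (he : ∀ s, |e s| ≤ M)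
    (h : Joins κ e a b ηm ηp) : ∃ x, IsTrajectory κ e a b x ∧ x a = ηm ∧ x b = ηp := by
  obtain ⟨y, w, h, hna, hnb, hm, hp⟩ := h
  refine ⟨_, h.isTrajectory fun s hs h0 => hna (h.eq_zero_of_eq_zero he hs
    (left_mem_Icc.2 hab) h0), (proj_eq_iff hna _).2 hm, (proj_eq_iff hnb _).2 hp⟩

/-- In both charts the right-hand side is affine in the control with continuous coefficients; this
turns the integrated equation into an a.e. derivative. -/
lemma HasAEDeriv.of_bounded_mul {X g h : ℝ → ℂ} (hab : a ≤ b) (hm : Measurable e)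
    (he : ∀ s, |e s| ≤ M) (hg : ContinuousOn g (Icc a b)) (hh : ContinuousOn h (Icc a b))
    (hX : ∀ s ∈ Icc a b, X s = X a + ∫ r in a..s, (g r + (e r : ℂ) * h r)) :
    HasAEDeriv X (fun r => g r + (e r : ℂ) * h r) a b := by
  obtain ⟨A, hA⟩ := isCompact_Icc.exists_bound_of_continuousOn hg
  obtain ⟨B, hB⟩ := isCompact_Icc.exists_bound_of_continuousOn hh
  have hbd : ∀ s ∈ Icc a b, ‖g s + (e s : ℂ) * h s‖ ≤ A + M * B := fun s hs => by
    refine (norm_add_le _ _).trans (add_le_add (hA s hs) ?_)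
    rw [norm_mul, Complex.norm_real, Real.norm_eq_abs]
    exact mul_le_mul (he s) (hB s hs) (norm_nonneg _) ((abs_nonneg _).trans (he s))
  refine HasAEDeriv.of_integral hab (K := A + M * B) ?_
    (Eventually.of_forall fun s hs => hbd s (Ioo_subset_Icc_self hs)) hX
  rw [intervalIntegrable_iff_integrableOn_Icc_of_le hab]
  refine Integrable.of_bound ((hg.aestronglyMeasurable measurableSet_Icc).add
    ((Complex.measurable_ofReal.comp hm).aestronglyMeasurable.mul
      (hh.aestronglyMeasurable measurableSet_Icc))) (A + M * B) ?_
  rw [ae_restrict_iff' measurableSet_Icc]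
  exact Eventually.of_forall hbd

/-- A piece of a trajectory inside the finite chart lifts to a solution. -/
lemma IsTrajectory.joins_chart (h : IsTrajectory κ e a b x) (hm : Measurable e)
    (he : ∀ s, |e s| ≤ M) (hac : a ≤ c) (hcd : c ≤ d) (hdb : d ≤ b)
    (hx : ∀ s ∈ Icc c d, x s ≠ OnePoint.infty) : Joins κ e c d (x c) (x d) := by
  set X : ℝ → ℂ := fun s => chart (x s) with hXdef
  have hXc : ContinuousOn X (Icc c d) := fun s hs =>
    (continuousAt_chart (hx s hs)).comp_continuousWithinAt
      ((h.continuousOn.mono (Icc_subset_Icc hac hdb)) s hs)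
  have hX : HasAEDeriv X (fun s => Complex.I * κ * (-(X s) ^ 2 + (e s : ℂ))) c d := by
    refine (HasAEDeriv.of_bounded_mul hcd hm he (g := fun s => Complex.I * κ * -(X s) ^ 2)
      (h := fun _ => Complex.I * κ) (continuousOn_const.mul (hXc.pow 2).neg) continuousOn_const
      fun s hs => ?_).congr_right fun s _ => by ring
    have := h.eq_chart c s hac hs.1 (hs.2.trans hdb) fun r hr => hx r ⟨hr.1, hr.2.trans hs.2⟩
    rw [sub_eq_iff_eq_add'] at this
    rw [hXdef]
    simp only
    rw [this]
    congr 1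
    exact intervalIntegral.integral_congr fun r _ => by ring
  -- With w = Xy the first equation becomes y' = iκXy, so y is the exponential of this primitive.
  have hP : HasAEDeriv (fun s => ∫ r in c..s, Complex.I * κ * X r)
      (fun s => Complex.I * κ * X s) c d :=
    HasAEDeriv.of_continuousOn hcd (continuousOn_const.mul hXc) fun s _ => by simp
  have hY := hP.cexp
  have hline : ∀ s ∈ Icc c d, ∀ u : ℂ, OnLine u (X s * u) (x s) := fun s hs u => by
    have := hx s hs
    change OnLine u (chart (x s) * u) (x s)
    generalize x s = η at this
    induction η using OnePoint.rec with
    | infty => exact absurd rfl this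
    | coe z => rfl
  refine ⟨fun s => Complex.exp (∫ r in c..s, Complex.I * κ * X r),
    fun s => X s * Complex.exp (∫ r in c..s, Complex.I * κ * X r),
    ⟨hY.congr_right fun s _ => by ring, (hX.mul hY).congr_right fun s _ => by ring⟩,
    fun h0 => Complex.exp_ne_zero _ h0.1, fun h0 => Complex.exp_ne_zero _ h0.1,
    hline c (left_mem_Icc.2 hcd) _, hline d (right_mem_Icc.2 hcd) _⟩

/-- A piece of a trajectory inside the chart at infinity lifts to a solution. -/
lemma IsTrajectory.joins_chartInf (h : IsTrajectory κ e a b x) (hm : Measurable e)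
    (he : ∀ s, |e s| ≤ M) (hac : a ≤ c) (hcd : c ≤ d) (hdb : d ≤ b)
    (hx : ∀ s ∈ Icc c d, x s ≠ OnePoint.some 0) : Joins κ e c d (x c) (x d) := by
  set Z : ℝ → ℂ := fun s => chartInf (x s) with hZdef
  have hZc : ContinuousOn Z (Icc c d) := fun s hs =>
    (continuousAt_chartInf (hx s hs)).comp_continuousWithinAt
      ((h.continuousOn.mono (Icc_subset_Icc hac hdb)) s hs)
  have hZ : HasAEDeriv Z (fun s => Complex.I * κ * (-1 + (e s : ℂ) * (Z s) ^ 2)) c d := by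
    refine (HasAEDeriv.of_bounded_mul hcd hm he (g := fun s => Complex.I * κ * -1)
      (h := fun s => Complex.I * κ * (Z s) ^ 2) continuousOn_const
      (continuousOn_const.mul (hZc.pow 2)) fun s hs => ?_).congr_right fun s _ => by ring
    have := h.eq_chartInf c s hac hs.1 (hs.2.trans hdb) fun r hr => hx r ⟨hr.1, hr.2.trans hs.2⟩
    rw [sub_eq_iff_eq_add'] at this
    rw [hZdef]
    simp only
    rw [this]
    congr 1
    exact intervalIntegral.integral_congr fun r _ => by ring
  -- With y = -Zw the second equation becomes w' = -iκ e Z w, so w is the exponential of this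
  -- primitive. The summand 0 fits the shape of `HasAEDeriv.of_bounded_mul`.
  have hP : HasAEDeriv (fun s => ∫ r in c..s, (0 + (e r : ℂ) * (-(Complex.I * κ) * Z r)))
      (fun s => 0 + (e s : ℂ) * (-(Complex.I * κ) * Z s)) c d :=
    HasAEDeriv.of_bounded_mul hcd hm he continuousOn_const (continuousOn_const.mul hZc)
      fun s _ => by simp
  have hW := hP.cexp
  have hline : ∀ s ∈ Icc c d, ∀ v : ℂ, OnLine (-(Z s * v)) v (x s) := fun s hs v => by
    have := hx s hs
    change OnLine (-(chartInf (x s) * v)) v (x s)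
    generalize x s = η at this
    induction η using OnePoint.rec with
    | infty =>
      change -((0 : ℂ) * v) = 0
      simp
    | coe z =>
      have hz : z ≠ 0 := fun h => this (by rw [h])
      change v = z * (-(-z⁻¹ * v))
      field_simp
  refine ⟨fun s => -(Z s * Complex.exp (∫ r in c..s, (0 + (e r : ℂ) * (-(Complex.I * κ) * Z r)))),
    fun s => Complex.exp (∫ r in c..s, (0 + (e r : ℂ) * (-(Complex.I * κ) * Z r))),
    ⟨(hZ.mul hW).neg.congr_right fun s _ => by ring, hW.congr_right fun s _ => by ring⟩,
    fun h0 => Complex.exp_ne_zero _ h0.2, fun h0 => Complex.exp_ne_zero _ h0.2,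
    hline c (left_mem_Icc.2 hcd) _, hline d (right_mem_Icc.2 hcd) _⟩

lemma OnLine.mul {η : Sphere} {u v : ℂ} (h : OnLine u v η) (l : ℂ) : OnLine (l * u) (l * v) η := by
  induction η using OnePoint.rec with
  | infty =>
    have h : u = 0 := h
    change l * u = 0
    rw [h, mul_zero]
  | coe z =>
    have h : v = z * u := h
    change l * v = z * (l * u)
    rw [h]; ring

lemma Joins.trans {η₁ η₂ η₃ : Sphere} (hac : a ≤ c) (hcb : c ≤ b) (h₁ : Joins κ e a c η₁ η₂)
    (h₂ : Joins κ e c b η₂ η₃) : Joins κ e a b η₁ η₃ := by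
  obtain ⟨y, w, h, hna, hnb, hm, hp⟩ := h₁
  obtain ⟨y', w', h', hna', hnb', hm', hp'⟩ := h₂
  -- At `c` the two solutions lie on the same line, so a constant multiple of the second continues
  -- the first.
  obtain ⟨l, hl, hy, hw⟩ := exists_mul_eq hna' hnb hm' hp
  have h'' := h'.const_mul l
  have hva : ∀ f g : ℝ → ℂ, (if a ≤ c then f a else g a) = f a := fun f g => if_pos hac
  -- If `c = b`, the glued function takes the first branch at `b`, hence the need for equal values
  -- there.
  have hvb : ∀ f g : ℝ → ℂ, f c = g c → (if b ≤ c then f b else g b) = g b := fun f g hfg => by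
    split_ifs with hbc
    · rw [le_antisymm hcb hbc] at hfg; exact hfg
    · rfl
  refine ⟨fun s => if s ≤ c then y s else l * y' s, fun s => if s ≤ c then w s else l * w' s,
    ⟨(h.left.glue hac hcb h''.left hy.symm).congr_right fun s _ => ?_,
      (h.right.glue hac hcb h''.right hw.symm).congr_right fun s _ => ?_⟩, ?_, ?_, ?_, ?_⟩
  · split_ifs <;> rfl
  · split_ifs <;> rfl
  · simp only [hva _ fun s => l * _]; exact hna
  · simp only [hvb y (fun s => l * y' s) hy.symm, hvb w (fun s => l * w' s) hw.symm]
    rintro ⟨h1, h2⟩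
    exact hnb' ⟨(mul_eq_zero.1 h1).resolve_left hl, (mul_eq_zero.1 h2).resolve_left hl⟩
  · simp only [hva _ fun s => l * _]; exact hm
  · simp only [hvb y (fun s => l * y' s) hy.symm, hvb w (fun s => l * w' s) hw.symm]
    exact hp'.mul l

/-- Trajectories on the sphere lift to solutions of the first order system. -/
lemma IsTrajectory.joins (h : IsTrajectory κ e a b x) (hm : Measurable e)
    (he : ∀ s, |e s| ≤ M) (hab : a ≤ b) : Joins κ e a b (x a) (x b) := by
  have hcont := continuousOn_iff_continuous_domRestrict.1 h.continuousOn
  let c : Bool → Set (Icc a b) := fun i => {s | x s ≠ if i then OnePoint.infty else OnePoint.some 0}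
  -- The two chart domains cover the sphere, so by compactness a finite subdivision has each piece
  -- inside one chart.
  obtain ⟨t, ht0, htm, ⟨m, hm'⟩, ht⟩ := exists_monotone_Icc_subset_open_cover_Icc hab (c := c)
    (fun i => (isClosed_singleton.isOpen_compl).preimage hcont) (by
      intro s _
      rw [mem_iUnion]
      by_cases hs : x s = OnePoint.infty
      · refine ⟨false, ?_⟩
        simp only [c, mem_ofPred_eq, hs]
        exact OnePoint.infty_ne_coe _
      · exact ⟨true, by simpa [c] using hs⟩)
  have step : ∀ n, Joins κ e (t n) (t (n + 1)) (x (t n)) (x (t (n + 1))) := fun n => by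
    obtain ⟨i, hi⟩ := ht n
    have hle : (t n : ℝ) ≤ t (n + 1) := htm n.le_succ
    have hi' : ∀ s ∈ Icc (t n : ℝ) (t (n + 1)), x s ≠ if i then OnePoint.infty else
        OnePoint.some 0 := fun s hs =>
      hi (show (⟨s, (t n).2.1.trans hs.1, hs.2.trans (t (n + 1)).2.2⟩ : Icc a b) ∈
        Icc (t n) (t (n + 1)) from hs)
    cases i with
    | false => exact h.joins_chartInf hm he (t n).2.1 hle (t (n + 1)).2.2 (by simpa using hi')
    | true => exact h.joins_chart hm he (t n).2.1 hle (t (n + 1)).2.2 (by simpa using hi')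
  have main : ∀ n, Joins κ e a (t (n + 1)) (x a) (x (t (n + 1))) := fun n => by
    induction n with
    | zero => simpa [ht0] using step 0
    | succ n ih => exact ih.trans (t (n + 1)).2.1 (htm (n + 1).le_succ) (step (n + 1))
  simpa [hm' (m + 1) m.le_succ] using main m

end Trajectories

/-! ### Compactness of the set of controls. -/

section Compactness

variable {a b : ℝ}

/-- Arzelà–Ascoli for sequences of uniformly Lipschitz functions. -/
lemma exists_subseq_tendsto {E : Type*} [NormedAddCommGroup E] [ProperSpace E] {f : ℕ → ℝ → E}
    {K : ℝ≥0} {R : ℝ} (hab : a ≤ b) (hL : ∀ n, LipschitzOnWith K (f n) (Icc a b))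
    (hB : ∀ n, ∀ s ∈ Icc a b, ‖f n s‖ ≤ R) :
    ∃ (g : ℝ → E) (φ : ℕ → ℕ), StrictMono φ ∧
      ∀ s ∈ Icc a b, Tendsto (fun n => f (φ n) s) atTop (𝓝 (g s)) := by
  let A : Set (BoundedContinuousFunction (Icc a b) E) :=
    {F | (∀ s t, dist (F s) (F t) ≤ K * dist s t) ∧ ∀ s, F s ∈ Metric.closedBall 0 R}
  have hev : ∀ s : Icc a b, Continuous fun F : BoundedContinuousFunction (Icc a b) E => F s :=
    fun s => BoundedContinuousFunction.lipschitz_eval_const s |>.continuous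
  have hAc : IsClosed A := by
    have h₁ : A = (⋂ s, ⋂ t, {F | dist (F s) (F t) ≤ K * dist s t}) ∩
        ⋂ s, {F | F s ∈ Metric.closedBall 0 R} := by
      ext F
      simp only [A, mem_inter_iff, mem_iInter, mem_ofPred_eq]
    rw [h₁]
    refine (isClosed_iInter fun s => isClosed_iInter fun t => ?_).inter (isClosed_iInter fun s => ?_)
    · exact isClosed_le ((hev s).dist (hev t)) continuous_const
    · exact Metric.isClosed_closedBall.preimage (hev s)
  have hA : IsCompact A := BoundedContinuousFunction.arzela_ascoli₂ _
    (isCompact_closedBall 0 R) A hAc (fun F s hF => hF.2 s)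
    (LipschitzWith.uniformEquicontinuous _ K fun F => LipschitzWith.of_dist_le_mul F.2.1).equicontinuous
  let F : ℕ → BoundedContinuousFunction (Icc a b) E := fun n =>
    BoundedContinuousFunction.mkOfCompact
      ⟨fun s => f n s, continuousOn_iff_continuous_domRestrict.1 (hL n).continuousOn⟩
  obtain ⟨G, -, φ, hφ, hG⟩ := hA.tendsto_subseq (x := F) fun n =>
    ⟨fun s t => (hL n).dist_le_mul s s.2 t t.2, fun s =>
      mem_closedBall_zero_iff.2 (hB n s s.2)⟩
  refine ⟨fun s => G (projIcc a b hab s), φ, hφ, fun s hs => ?_⟩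
  have h := ((hev ⟨s, hs⟩).tendsto G).comp hG
  simp only [projIcc_of_mem hab hs]
  exact h

lemma HasAEDeriv.lipschitzOnWith {E : Type*} [NormedAddCommGroup E] [NormedSpace ℝ E]
    [CompleteSpace E] {f f' : ℝ → E} {K : ℝ≥0} (h : HasAEDeriv f f' a b)
    (hK : ∀ s ∈ Icc a b, ‖f' s‖ ≤ K) : LipschitzOnWith K f (Icc a b) := by
  have key : ∀ s ∈ Icc a b, ∀ t ∈ Icc a b, s ≤ t → dist (f s) (f t) ≤ K * dist s t := by
    intro s hs t ht hst
    rw [h.eq_integral_of_le hs.1 hst ht.2, dist_comm, dist_eq_norm, add_sub_cancel_left,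
      dist_comm, Real.dist_eq]
    refine intervalIntegral.norm_integral_le_of_norm_le_const fun r hr => hK r ?_
    rw [uIoc_of_le hst] at hr
    exact ⟨hs.1.trans hr.1.le, hr.2.trans ht.2⟩
  refine LipschitzOnWith.of_dist_le_mul fun s hs t ht => ?_
  rcases le_total s t with hst | hst
  · exact key s hs t ht hst
  · rw [dist_comm, dist_comm s]; exact key t ht s hs hst

/-- Recovers a control from a limit of primitives: bounds on difference quotients survive pointwise
limits, and a Lipschitz function is differentiable almost everywhere. Clamping `deriv F` makes the
bounds hold at every point. -/
lemma exists_hasAEDeriv_of_slope_mem {F : ℝ → ℝ} {m M : ℝ} (hm : 0 ≤ m) (hmM : m ≤ M)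
    (hF : ∀ s ∈ Icc a b, ∀ t ∈ Icc a b, s ≤ t →
      m * (t - s) ≤ F t - F s ∧ F t - F s ≤ M * (t - s)) :
    ∃ e : ℝ → ℝ, Measurable e ∧ (∀ s, m ≤ e s ∧ e s ≤ M) ∧ HasAEDeriv F e a b := by
  have hL : LipschitzOnWith M.toNNReal F (Icc a b) := by
    have key : ∀ s ∈ Icc a b, ∀ t ∈ Icc a b, s ≤ t → dist (F s) (F t) ≤ M * dist s t := by
      intro s hs t ht hst
      have := hF s hs t ht hst
      have : 0 ≤ m * (t - s) := mul_nonneg hm (sub_nonneg.2 hst)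
      rw [dist_comm, Real.dist_eq, dist_comm, Real.dist_eq, abs_of_nonneg (by linarith),
        abs_of_nonneg (by linarith)]
      linarith
    refine LipschitzOnWith.of_dist_le_mul fun s hs t ht => ?_
    rw [Real.coe_toNNReal _ (hm.trans hmM)]
    rcases le_total s t with hst | hst
    · exact key s hs t ht hst
    · rw [dist_comm, dist_comm s]; exact key t ht s hs hst
  refine ⟨fun s => max m (min M (deriv F s)),
    measurable_const.max (measurable_const.min (measurable_deriv F)),
    fun s => ⟨le_max_left _ _, max_le hmM (min_le_left _ _)⟩, ⟨_, hL⟩, ?_⟩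
  filter_upwards [hL.ae_differentiableWithinAt_of_mem_real] with s hs hab
  have hd := ((hs (Ioo_subset_Icc_self hab)).differentiableAt (Icc_mem_nhds hab.1 hab.2)).hasDerivAt
  have hslope : ∀ᶠ t in 𝓝[≠] s, slope F s t ∈ Icc m M := by
    have h₁ : ∀ᶠ t in 𝓝[≠] s, t ∈ Icc a b :=
      mem_nhdsWithin_of_mem_nhds (Icc_mem_nhds hab.1 hab.2)
    filter_upwards [h₁, self_mem_nhdsWithin] with t ht hts
    rcases lt_or_gt_of_ne (show t ≠ s from hts) with h | h
    · have := hF t ht s (Ioo_subset_Icc_self hab) h.le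
      rw [slope_comm, slope_def_field]
      exact ⟨(le_div_iff₀ (by linarith)).2 this.1, (div_le_iff₀ (by linarith)).2 this.2⟩
    · have := hF s (Ioo_subset_Icc_self hab) t ht h.le
      rw [slope_def_field]
      exact ⟨(le_div_iff₀ (by linarith)).2 this.1, (div_le_iff₀ (by linarith)).2 this.2⟩
  have hmem : deriv F s ∈ Icc m M :=
    isClosed_Icc.mem_of_tendsto (hasDerivAt_iff_tendsto_slope.1 hd) hslope
  rwa [min_eq_right hmem.2, max_eq_right hmem.1]

lemma tendsto_integral_of_bounded {f : ℕ → ℝ → ℂ} {g : ℝ → ℂ} {B : ℝ}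
    (hc : ∀ n, ContinuousOn (f n) (Icc a b)) (hB : ∀ n, ∀ s ∈ Icc a b, ‖f n s‖ ≤ B)
    (hg : ∀ s ∈ Icc a b, Tendsto (fun n => f n s) atTop (𝓝 (g s))) {s : ℝ} (hs : s ∈ Icc a b) :
    Tendsto (fun n => ∫ r in a..s, f n r) atTop (𝓝 (∫ r in a..s, g r)) := by
  have hsub : ∀ r, r ∈ uIoc a s → r ∈ Icc a b := fun r hr => by
    rw [uIoc_of_le hs.1] at hr
    exact ⟨hr.1.le, hr.2.trans hs.2⟩
  refine intervalIntegral.tendsto_integral_filter_of_dominated_convergence (fun _ => B)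
    (Eventually.of_forall fun n => ?_)
    (Eventually.of_forall fun n => Eventually.of_forall fun r hr => hB n r (hsub r hr))
    intervalIntegrable_const (Eventually.of_forall fun r hr => hg r (hsub r hr))
  exact ((hc n).mono hsub).aestronglyMeasurable measurableSet_uIoc

lemma le_one_add_sq (t : ℝ) : t ≤ 1 + t ^ 2 := by nlinarith [sq_nonneg (t - 1)]

/-- Compactness of the family of controls: joining two points of the sphere passes to the limit. -/
lemma Joins.of_tendsto {κs : ℕ → ℂ} {κ : ℂ} {es : ℕ → ℝ → ℝ} {m M : ℝ} {ηm ηp : Sphere}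
    (hab : a ≤ b) (hκ : Tendsto κs atTop (𝓝 κ)) (hm : 0 ≤ m) (hmM : m ≤ M)
    (hmeas : ∀ n, Measurable (es n)) (hes : ∀ n s, m ≤ es n s ∧ es n s ≤ M)
    (h : ∀ n, Joins (κs n) (es n) a b ηm ηp) :
    ∃ e : ℝ → ℝ, Measurable e ∧ (∀ s, m ≤ e s ∧ e s ≤ M) ∧ Joins κ e a b ηm ηp := by
  have haI : a ∈ Icc a b := left_mem_Icc.2 hab
  have hbI : b ∈ Icc a b := right_mem_Icc.2 hab
  have hM : 0 ≤ M := hm.trans hmM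
  have habs : ∀ n s, |es n s| ≤ M := fun n s => abs_le.2 ⟨by linarith [(hes n s).1], (hes n s).2⟩
  obtain ⟨u₀, v₀, h₀, hl₀, hrep⟩ := exists_rep ηm
  -- Normalising all solutions to one initial vector bounds them uniformly and keeps the limit from
  -- vanishing.
  have hsol : ∀ n, ∃ y w, LinSol (κs n) (es n) a b y w ∧ y a = u₀ ∧ w a = v₀ ∧
      OnLine (y b) (w b) ηp := fun n => by
    obtain ⟨y, w, hs, hna, hnb, hm, hp⟩ := h n
    obtain ⟨l, hl, hu, hv⟩ := hrep _ _ hna hm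
    exact ⟨_, _, hs.const_mul l, hu, hv, hp.mul l⟩
  choose y w hlin hya hwa hyp using hsol
  obtain ⟨k, hk⟩ := (Metric.isBounded_range_of_tendsto κs hκ).exists_norm_le
  have hk : ∀ n, ‖κs n‖ ≤ k := fun n => hk _ (mem_range_self n)
  have hk0 : 0 ≤ k := (norm_nonneg _).trans (hk 0)
  -- The added 1 makes `R` bound the norms themselves, through t ≤ 1 + t².
  obtain ⟨R, hR⟩ : ∃ R, R = 1 + (‖u₀‖ ^ 2 + ‖v₀‖ ^ 2) * Real.exp (k * (1 + M) * (b - a)) :=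
    ⟨_, rfl⟩
  have hN : ∀ n, ∀ s ∈ Icc a b, 1 + (‖y n s‖ ^ 2 + ‖w n s‖ ^ 2) ≤ R := fun n s hs => by
    have h₁ := ((hlin n).mono le_rfl hs.2).normSq_le (habs n) hs.1
    rw [hya, hwa] at h₁
    rw [hR]
    gcongr
    refine h₁.trans ?_
    have := hk n
    have := hs.1
    have := hs.2
    gcongr
  have hyR : ∀ n, ∀ s ∈ Icc a b, ‖y n s‖ ≤ R := fun n s hs => by
    linarith [hN n s hs, le_one_add_sq ‖y n s‖, sq_nonneg ‖w n s‖]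
  have hwR : ∀ n, ∀ s ∈ Icc a b, ‖w n s‖ ≤ R := fun n s hs => by
    linarith [hN n s hs, le_one_add_sq ‖w n s‖, sq_nonneg ‖y n s‖]
  have hR0 : 0 ≤ R := (norm_nonneg _).trans (hyR 0 a haI)
  have hint : ∀ n c d, IntervalIntegrable (es n) volume c d := fun n c d => by
    rw [intervalIntegrable_iff]
    have : IsFiniteMeasure (volume.restrict (uIoc c d)) := ⟨by simp [uIoc]⟩
    exact Integrable.of_bound (hmeas n).aestronglyMeasurable M
      (Eventually.of_forall fun s => habs n s)
  -- The primitives, unlike the controls, have a uniformly convergent subsequence.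
  let P : ℕ → ℝ → ℝ := fun n s => ∫ r in a..s, es n r
  have hP : ∀ n, HasAEDeriv (P n) (es n) a b := fun n =>
    HasAEDeriv.of_integral hab (hint n a b) (Eventually.of_forall fun s _ => habs n s)
      fun s _ => by simp [P]
  have hPs : ∀ n, ∀ s ∈ Icc a b, ∀ t ∈ Icc a b, s ≤ t →
      m * (t - s) ≤ P n t - P n s ∧ P n t - P n s ≤ M * (t - s) := fun n s hs t ht hst => by
    rw [(hP n).eq_integral_of_le hs.1 hst ht.2, add_sub_cancel_left]
    have h₁ := intervalIntegral.integral_mono_on hst intervalIntegrable_const (hint n s t)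
      fun r _ => (hes n r).1
    have h₂ := intervalIntegral.integral_mono_on hst (hint n s t) intervalIntegrable_const
      fun r _ => (hes n r).2
    simp only [intervalIntegral.integral_const, smul_eq_mul] at h₁ h₂
    constructor <;> linarith
  have hPR : ∀ n, ∀ s ∈ Icc a b, ‖P n s‖ ≤ M * (b - a) := fun n s hs => by
    have h₁ := hPs n a haI s hs hs.1
    have h₂ : P n a = 0 := by simp [P]
    rw [h₂, sub_zero] at h₁
    have h₃ := mul_nonneg hm (sub_nonneg.2 hs.1)
    have h₄ := mul_le_mul_of_nonneg_left hs.2 hM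
    rw [Real.norm_of_nonneg (by linarith)]
    linarith
  have hIk : ∀ n (z : ℂ), ‖Complex.I * κs n * z‖ ≤ k * ‖z‖ := fun n z => by
    rw [norm_mul, norm_mul, Complex.norm_I, one_mul]
    gcongr
    exact hk n
  have hyL : ∀ n, LipschitzOnWith (k * R).toNNReal (y n) (Icc a b) := fun n =>
    (hlin n).left.lipschitzOnWith fun s hs => ((hIk n _).trans (by
      have := hwR n s hs
      gcongr)).trans (Real.le_coe_toNNReal _)
  have hwL : ∀ n, LipschitzOnWith (k * (M * R)).toNNReal (w n) (Icc a b) := fun n =>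
    (hlin n).right.lipschitzOnWith fun s hs => ((hIk n _).trans (by
      have := hyR n s hs
      have := habs n s
      rw [norm_mul, Complex.norm_real, Real.norm_eq_abs]
      gcongr)).trans (Real.le_coe_toNNReal _)
  have hPL : ∀ n, LipschitzOnWith M.toNNReal (P n) (Icc a b) := fun n =>
    (hP n).lipschitzOnWith fun s hs => (habs n s).trans (Real.le_coe_toNNReal _)
  -- The triple (y, w, P) is treated as one function, so that one subsequence serves all three.
  obtain ⟨G, φ, hφ, hG⟩ := exists_subseq_tendsto hab
    (fun n => (hyL n).prodMk ((hwL n).prodMk (hPL n))) (R := max R (max R (M * (b - a))))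
    (fun n s hs => by
      exact max_le_max (hyR n s hs) (max_le_max (hwR n s hs) (hPR n s hs)))
  have hGy : ∀ s ∈ Icc a b, Tendsto (fun n => y (φ n) s) atTop (𝓝 (G s).1) :=
    fun s hs => (hG s hs).fst_nhds
  have hGw : ∀ s ∈ Icc a b, Tendsto (fun n => w (φ n) s) atTop (𝓝 (G s).2.1) :=
    fun s hs => (hG s hs).snd_nhds.fst_nhds
  have hGP : ∀ s ∈ Icc a b, Tendsto (fun n => P (φ n) s) atTop (𝓝 (G s).2.2) :=
    fun s hs => (hG s hs).snd_nhds.snd_nhds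
  have hκφ := hκ.comp hφ.tendsto_atTop
  obtain ⟨e, hem, heb, hPe⟩ := exists_hasAEDeriv_of_slope_mem (F := fun s => (G s).2.2) (a := a)
    (b := b) hm hmM fun s hs t ht hst => by
      have hlim := (hGP t ht).sub (hGP s hs)
      exact ⟨ge_of_tendsto' hlim fun n => (hPs _ s hs t ht hst).1,
        le_of_tendsto' hlim fun n => (hPs _ s hs t ht hst).2⟩
  have hwc : ContinuousOn (fun s => (G s).2.1) (Icc a b) := by
    refine LipschitzOnWith.continuousOn (K := (k * (M * R)).toNNReal)
      (LipschitzOnWith.of_dist_le_mul fun s hs t ht => ?_)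
    exact le_of_tendsto' ((hGw s hs).dist (hGw t ht)) fun n => (hwL _).dist_le_mul s hs t ht
  have hyint : ∀ s ∈ Icc a b, (G s).1 = u₀ + ∫ r in a..s, Complex.I * κ * (G r).2.1 := by
    intro s hs
    refine tendsto_nhds_unique (hGy s hs) ?_
    have h₁ := tendsto_integral_of_bounded (B := k * R)
      (f := fun n r => Complex.I * κs (φ n) * w (φ n) r)
      (g := fun r => Complex.I * κ * (G r).2.1)
      (fun n => continuousOn_const.mul (hlin _).right.continuousOn)
      (fun n r hr => (hIk _ _).trans (by have := hwR (φ n) r hr; gcongr))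
      (fun r hr => (hκφ.const_mul Complex.I).mul (hGw r hr)) hs
    refine (h₁.const_add u₀).congr fun n => ?_
    rw [(hlin (φ n)).left.eq_integral_of_le le_rfl hs.1 hs.2, hya]
  -- Integration by parts: ∫ e y = P y - ∫ P y', with y' = iκw and P = 0 at `a`. No control remains,
  -- so each term converges.
  have hwint : ∀ s ∈ Icc a b, (G s).2.1 = v₀ + Complex.I * κ * ((G s).2.2 * (G s).1 -
      ∫ r in a..s, (G r).2.2 * (Complex.I * κ * (G r).2.1)) := by
    intro s hs
    refine tendsto_nhds_unique (hGw s hs) ?_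
    have h₁ := tendsto_integral_of_bounded (B := M * (b - a) * (k * R))
      (f := fun n r => (P (φ n) r : ℂ) * (Complex.I * κs (φ n) * w (φ n) r))
      (g := fun r => ((G r).2.2 : ℂ) * (Complex.I * κ * (G r).2.1))
      (fun n => (hP _).ofReal.continuousOn.mul
        (continuousOn_const.mul (hlin _).right.continuousOn))
      (fun n r hr => by
        rw [norm_mul, Complex.norm_real]
        have h₁ := hPR (φ n) r hr
        refine mul_le_mul h₁ ((hIk _ _).trans ?_) (norm_nonneg _) ((norm_nonneg _).trans h₁)
        have := hwR (φ n) r hr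
        gcongr)
      (fun r hr => ((Complex.continuous_ofReal.tendsto _).comp (hGP r hr)).mul
        ((hκφ.const_mul Complex.I).mul (hGw r hr))) hs
    have h₂ := ((Complex.continuous_ofReal.tendsto _).comp (hGP s hs)).mul (hGy s hs)
    refine (((hκφ.const_mul Complex.I).mul (h₂.sub h₁)).const_add v₀).congr fun n => ?_
    have hprod := ((hP (φ n)).ofReal.mul (hlin (φ n)).left).mono le_rfl hs.2
    have hw' := ((hlin (φ n)).right.mono le_rfl hs.2)
    have hPw : ContinuousOn (fun r => (P (φ n) r : ℂ) * (Complex.I * κs (φ n) * w (φ n) r))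
        (Icc a s) := ((hP _).ofReal.continuousOn.mul
        (continuousOn_const.mul (hlin _).right.continuousOn)).mono (Icc_subset_Icc_right hs.2)
    have hsub := ((hprod.sub (HasAEDeriv.of_continuousOn
      (f := fun t => ∫ r in a..t, (P (φ n) r : ℂ) * (Complex.I * κs (φ n) * w (φ n) r)) hs.1 hPw
      fun t _ => by simp)).const_mul (Complex.I * κs (φ n))).sub hw'
    have hfin := (hsub.congr_right (g' := fun _ => 0) fun r _ => by ring).eq_integral hs.1
    simp only [intervalIntegral.integral_zero, add_zero, intervalIntegral.integral_same,
      sub_zero, hwa] at hfin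
    have hPa : P (φ n) a = 0 := by simp [P]
    rw [hPa, Complex.ofReal_zero, zero_mul, mul_zero, zero_sub] at hfin
    simp only [Function.comp_apply]
    linear_combination hfin
  have hya' : (G a).1 = u₀ := by simpa using hyint a haI
  have hwa' : (G a).2.1 = v₀ := by
    refine tendsto_nhds_unique (hGw a haI) ?_
    simp [hwa]
  have hyD : HasAEDeriv (fun s => (G s).1) (fun s => Complex.I * κ * (G s).2.1) a b :=
    HasAEDeriv.of_continuousOn hab (continuousOn_const.mul hwc) fun s hs => by
      rw [hya']; exact hyint s hs
  have hwD : HasAEDeriv (fun s => (G s).2.1) (fun s => Complex.I * κ * ((e s : ℂ) * (G s).1))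
      a b := by
    have hPc := hPe.ofReal.continuousOn
    have h₁ : HasAEDeriv (fun s => ∫ r in a..s, ((G r).2.2 : ℂ) * (Complex.I * κ * (G r).2.1))
        (fun r => ((G r).2.2 : ℂ) * (Complex.I * κ * (G r).2.1)) a b :=
      HasAEDeriv.of_continuousOn hab (hPc.mul (continuousOn_const.mul hwc)) fun s _ => by simp
    -- Differentiating the limit identity undoes the integration by parts: the terms with P y'
    -- cancel and e y remains.
    refine ((HasAEDeriv.const v₀).add (((hPe.ofReal.mul hyD).sub h₁).const_mul
      (Complex.I * κ))).congr hwint fun s _ => ?_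
    ring
  have hlim : LinSol κ e a b (fun s => (G s).1) (fun s => (G s).2.1) := ⟨hyD, hwD⟩
  refine ⟨e, hem, heb, _, _, hlim, by simpa only [hya', hwa'] using h₀, fun hb0 => ?_,
    by simpa only [hya', hwa'] using hl₀, ?_⟩
  · have := hlim.eq_zero_of_eq_zero (M := M)
      (fun s => abs_le.2 ⟨by linarith [(heb s).1], (heb s).2⟩) hbI haI hb0
    simp only [hya', hwa'] at this
    exact h₀ this
  · exact (isClosed_onLine ηp).mem_of_tendsto ((hGy b hbI).prodMk_nhds (hGw b hbI))
      (Eventually.of_forall fun n => hyp _)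

end Compactness

/-! ### From classes in L^∞ to coefficients bounded everywhere. -/

section Reduction

variable {κ : ℂ} {e e' ε : ℝ → ℝ} {a b m M : ℝ} {ηm ηp : Sphere}

/-- A coefficient that is measurable and takes values in `[m, M]` everywhere. -/
structure IsControl (m M : ℝ) (e : ℝ → ℝ) : Prop where
  measurable : Measurable e
  mem : ∀ s, m ≤ e s ∧ e s ≤ M

lemma IsControl.abs_le (hm : 0 ≤ m) (he : IsControl m M e) (s : ℝ) : |e s| ≤ M :=
  _root_.abs_le.2 ⟨by linarith [(he.mem s).1, (he.mem s).2], (he.mem s).2⟩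

lemma IsControl.comp_affine (he : IsControl m M e) (p r c : ℝ) :
    IsControl m M (fun s => e (p + r * (s - c))) :=
  ⟨he.measurable.comp (by fun_prop), fun _ => he.mem _⟩

/-- Clamping alters a representative only on a null set within `I`, and gives a coefficient defined
and bounded on the whole line, which can then be shifted and rescaled freely. -/
lemma Feasible.exists_isControl {n₁ n₂ : ℝ} (h : n₁ ^ 2 ≤ n₂ ^ 2) {I : Set ℝ} {ε : Linf I}
    (hε : ε ∈ Feasible n₁ n₂ I) :
    ∃ e, IsControl (n₁ ^ 2) (n₂ ^ 2) e ∧ e =ᵐ[volume.restrict I] ε := by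
  refine ⟨fun s => max (n₁ ^ 2) (min (n₂ ^ 2) (ε s)),
    ⟨measurable_const.max (measurable_const.min (Lp.stronglyMeasurable ε).measurable),
      fun s => ⟨le_max_left _ _, max_le h (min_le_left _ _)⟩⟩, ?_⟩
  filter_upwards [hε] with s hs
  rw [min_eq_right hs.2, max_eq_right hs.1]

lemma IsControl.exists_feasible {n₁ n₂ : ℝ} (he : IsControl (n₁ ^ 2) (n₂ ^ 2) e) (I : Set ℝ) :
    ∃ ε ∈ Feasible n₁ n₂ I, e =ᵐ[volume.restrict I] ε := by
  have hL : MemLp e ∞ (volume.restrict I) :=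
    memLp_top_of_bound he.measurable.aestronglyMeasurable (n₂ ^ 2)
      (Eventually.of_forall fun s => he.abs_le (sq_nonneg n₁) s)
  refine ⟨hL.toLp e, ?_, hL.coeFn_toLp.symm⟩
  filter_upwards [hL.coeFn_toLp] with s hs
  rw [hs]; exact he.mem s

lemma intervalIntegral_congr_ae_Ioo {f g : ℝ → ℂ} {c d : ℝ} (hac : a ≤ c) (hcd : c ≤ d)
    (hdb : d ≤ b) (h : ∀ᵐ s, s ∈ Ioo a b → f s = g s) :
    ∫ s in c..d, f s = ∫ s in c..d, g s := by
  rw [intervalIntegral.integral_of_le hcd, intervalIntegral.integral_of_le hcd,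
    integral_Ioc_eq_integral_Ioo, integral_Ioc_eq_integral_Ioo]
  refine setIntegral_congr_ae measurableSet_Ioo ?_
  filter_upwards [h] with s hs hs' using hs (Ioo_subset_Ioo hac hdb hs')

lemma IsSolution.congr_ae {y dy : ℝ → ℂ} (h : IsSolution κ e a b y dy)
    (he : ∀ᵐ s, s ∈ Ioo a b → e' s = e s) : IsSolution κ e' a b y dy := by
  refine ⟨h.hasDeriv, fun s hs => ?_⟩
  rw [h.eq_integral s hs]
  congr 1
  refine intervalIntegral_congr_ae_Ioo le_rfl hs.1 hs.2 ?_
  filter_upwards [he] with r hr hr'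
  rw [hr hr']

lemma IsTrajectory.congr_ae {x : ℝ → Sphere} (h : IsTrajectory κ e a b x)
    (he : ∀ᵐ s, s ∈ Ioo a b → e' s = e s) : IsTrajectory κ e' a b x := by
  refine ⟨h.continuousOn, fun c d hac hcd hdb hx => ?_, fun c d hac hcd hdb hx => ?_⟩
  · rw [h.eq_chart c d hac hcd hdb hx]
    refine intervalIntegral_congr_ae_Ioo hac hcd hdb ?_
    filter_upwards [he] with r hr hr'
    rw [hr hr']
  · rw [h.eq_chartInf c d hac hcd hdb hx]
    refine intervalIntegral_congr_ae_Ioo hac hcd hdb ?_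
    filter_upwards [he] with r hr hr'
    rw [hr hr']

lemma Joins.comp_affine {p q r : ℝ} (hr : 0 < r) (hq : q = p + r * (b - a))
    (h : Joins κ e p q ηm ηp) :
    Joins (r * κ) (fun s => e (p + r * (s - a))) a b ηm ηp := by
  obtain ⟨y, w, h, hna, hnb, hm, hp⟩ := h
  exact ⟨_, _, h.comp_affine hr hq, by simpa using hna, by simpa [← hq] using hnb,
    by simpa using hm, by simpa [← hq] using hp⟩

/-- For zero length or κ = 0 the solution has equal end values. With distinct end states this
excludes steering time 0 and limiting modulus 0. -/
lemma Joins.eq_of_eq_or_eq_zero (hab : a ≤ b) (h : Joins κ e a b ηm ηp) (h0 : a = b ∨ κ = 0) :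
    ηm = ηp := by
  obtain ⟨y, w, h, hna, hnb, hm, hp⟩ := h
  have key : y b = y a ∧ w b = w a := by
    rcases h0 with rfl | rfl
    · exact ⟨rfl, rfl⟩
    · rw [h.left.eq_integral hab, h.right.eq_integral hab]
      simp
  rw [key.1, key.2] at hp
  rw [← (proj_eq_iff hna _).2 hm, (proj_eq_iff hna _).2 hp]

lemma mem_eigenvalues_iff_of_ae (hκ : κ ≠ 0) (hab : a < b) (hm : 0 ≤ m) (he : IsControl m M e)
    (hε : e =ᵐ[volume.restrict (Ioo a b)] ε) :
    κ ∈ eigenvalues a b ηm ηp ε ↔ Joins κ e a b ηm ηp := by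
  rw [← mem_eigenvalues_iff hκ hab he.measurable (he.abs_le hm)]
  rw [EventuallyEq, ae_restrict_iff' measurableSet_Ioo] at hε
  have hε' : ∀ᵐ s, s ∈ Ioo a b → ε s = e s := by
    filter_upwards [hε] with s hs hs' using (hs hs').symm
  constructor
  · rintro ⟨h, y, dy, hs, H⟩
    exact ⟨h, y, dy, hs.congr_ae hε, H⟩
  · rintro ⟨h, y, dy, hs, H⟩
    exact ⟨h, y, dy, hs.congr_ae hε', H⟩

lemma steers_iff_of_ae {sm : ℝ} {t : ℝ≥0} (hm : 0 ≤ m) (he : IsControl m M e)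
    (hε : e =ᵐ[volume.restrict (Ioi sm)] ε) :
    Steers κ sm ε ηm ηp t ↔ Joins κ e sm (sm + t) ηm ηp := by
  rw [EventuallyEq, ae_restrict_iff' measurableSet_Ioi] at hε
  have hle : sm ≤ sm + t := le_add_of_nonneg_right t.2
  constructor
  · rintro ⟨x, hx, rfl, rfl⟩
    refine (hx.congr_ae (e' := e) ?_).joins he.measurable (he.abs_le hm) hle
    filter_upwards [hε] with s hs hs' using hs hs'.1
  · intro h
    obtain ⟨x, hx, h₁, h₂⟩ := h.exists_isTrajectory hle (he.abs_le hm)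
    refine ⟨x, hx.congr_ae ?_, h₁, h₂⟩
    filter_upwards [hε] with s hs hs' using (hs hs'.1).symm

/-! ### Rescaling: steering times and moduli on a ray. -/

section Moduli

variable {n₁ n₂ sm sp γ : ℝ}

/-- The moduli of the achievable eigenvalues on the ray with complex argument `γ`. -/
def moduli (n₁ n₂ a b γ : ℝ) (ηm ηp : Sphere) : Set ℝ :=
  {ρ | 0 < ρ ∧ ∃ e, IsControl (n₁ ^ 2) (n₂ ^ 2) e ∧
    Joins (ρ * Complex.exp (Complex.I * γ)) e a b ηm ηp}

lemma ofReal_mul_exp_ne_zero {ρ : ℝ} (hρ : 0 < ρ) (γ : ℝ) :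
    (ρ : ℂ) * Complex.exp (Complex.I * γ) ≠ 0 :=
  mul_ne_zero (Complex.ofReal_ne_zero.2 hρ.ne') (Complex.exp_ne_zero _)

lemma norm_mul_exp_arg (κ : ℂ) : (‖κ‖ : ℂ) * Complex.exp (Complex.I * κ.arg) = κ := by
  rw [mul_comm Complex.I]; exact Complex.norm_mul_exp_arg_mul_I κ

lemma arg_ofReal_mul_exp {ρ : ℝ} (hρ : 0 < ρ) (hγ : γ ∈ Ioc (-Real.pi) Real.pi) :
    ((ρ : ℂ) * Complex.exp (Complex.I * γ)).arg = γ := by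
  rw [mul_comm Complex.I, Complex.exp_mul_I, Complex.arg_mul_cos_add_sin_mul_I hρ hγ]

lemma norm_ofReal_mul_exp {ρ : ℝ} (hρ : 0 < ρ) (γ : ℝ) :
    ‖(ρ : ℂ) * Complex.exp (Complex.I * γ)‖ = ρ := by
  rw [norm_mul, mul_comm Complex.I, Complex.norm_exp_ofReal_mul_I, mul_one, Complex.norm_real,
    Real.norm_of_nonneg hρ.le]

lemma mem_achievable_iff (hn : n₁ ^ 2 ≤ n₂ ^ 2) (hab : a < b) :
    κ ∈ achievable n₁ n₂ a b ηm ηp ↔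
      κ ≠ 0 ∧ ∃ e, IsControl (n₁ ^ 2) (n₂ ^ 2) e ∧ Joins κ e a b ηm ηp := by
  simp only [achievable, mem_iUnion]
  constructor
  · rintro ⟨ε, hε, h⟩
    obtain ⟨e, he, hee⟩ := Feasible.exists_isControl hn hε
    exact ⟨h.1, e, he, (mem_eigenvalues_iff_of_ae h.1 hab (sq_nonneg n₁) he hee).1 h⟩
  · rintro ⟨hκ, e, he, h⟩
    obtain ⟨ε, hε, hee⟩ := he.exists_feasible (Ioo a b)
    exact ⟨ε, hε, (mem_eigenvalues_iff_of_ae hκ hab (sq_nonneg n₁) he hee).2 h⟩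

lemma mem_controllableAt_iff (hn : n₁ ^ 2 ≤ n₂ ^ 2) {t : ℝ≥0} :
    ηm ∈ controllableAt n₁ n₂ sm ηp κ t ↔
      ∃ e, IsControl (n₁ ^ 2) (n₂ ^ 2) e ∧ Joins κ e sm (sm + t) ηm ηp := by
  constructor
  · rintro ⟨ε, hε, h⟩
    obtain ⟨e, he, hee⟩ := Feasible.exists_isControl hn hε
    exact ⟨e, he, (steers_iff_of_ae (sq_nonneg n₁) he hee).1 h⟩
  · rintro ⟨e, he, h⟩
    obtain ⟨ε, hε, hee⟩ := he.exists_feasible (Ioi sm)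
    exact ⟨ε, hε, (steers_iff_of_ae (sq_nonneg n₁) he hee).2 h⟩

lemma mem_achievable_and_arg_iff (hn : n₁ ^ 2 ≤ n₂ ^ 2) (hab : a < b)
    (hγ : γ ∈ Ioc (-Real.pi) Real.pi) :
    (κ ∈ achievable n₁ n₂ a b ηm ηp ∧ κ.arg = γ) ↔
      ∃ ρ ∈ moduli n₁ n₂ a b γ ηm ηp, κ = ρ * Complex.exp (Complex.I * γ) := by
  rw [mem_achievable_iff hn hab]
  constructor
  · rintro ⟨⟨hκ, e, he, h⟩, rfl⟩
    exact ⟨‖κ‖, ⟨norm_pos_iff.2 hκ, e, he, by rwa [norm_mul_exp_arg]⟩, (norm_mul_exp_arg κ).symm⟩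
  · rintro ⟨ρ, ⟨hρ, h⟩, rfl⟩
    exact ⟨⟨ofReal_mul_exp_ne_zero hρ γ, h⟩, arg_ofReal_mul_exp hρ hγ⟩

/-- Rescaling of the interval identifies steering times with moduli of eigenvalues. -/
lemma mem_controllableAt_iff_moduli (hn : n₁ ^ 2 ≤ n₂ ^ 2) (hs : sm < sp) (hη : ηm ≠ ηp)
    (hκ : κ ≠ 0) {t : ℝ≥0} :
    ηm ∈ controllableAt n₁ n₂ sm ηp κ t ↔
      (t : ℝ) * ‖κ‖ / (sp - sm) ∈ moduli n₁ n₂ sm sp κ.arg ηm ηp := by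
  have hL : 0 < sp - sm := sub_pos.2 hs
  have hκ' : 0 < ‖κ‖ := norm_pos_iff.2 hκ
  rw [mem_controllableAt_iff hn]
  have hpos : ∀ r : ℝ, ((r * ‖κ‖ : ℝ) : ℂ) * Complex.exp (Complex.I * κ.arg) = r * κ := fun r => by
    rw [Complex.ofReal_mul, mul_assoc, norm_mul_exp_arg]
  rw [mul_div_right_comm]
  constructor
  · rintro ⟨e, he, h⟩
    have ht : (0 : ℝ) < t := by
      refine lt_of_le_of_ne t.2 fun h0 => hη (h.eq_of_eq_or_eq_zero (by simp) (Or.inl ?_))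
      rw [← h0, add_zero]
    -- The factor t/(sp - sm) stretches [sm, sp] to [sm, sm + t]; pulling back along it multiplies κ
    -- by the same factor.
    have hr : 0 < t / (sp - sm) := div_pos ht hL
    refine ⟨mul_pos hr hκ', _, he.comp_affine sm (t / (sp - sm)) sm, ?_⟩
    rw [hpos]
    exact h.comp_affine hr (by field_simp)
  · rintro ⟨h0, e, he, h⟩
    have hr : 0 < t / (sp - sm) := pos_of_mul_pos_left h0 hκ'.le
    have ht : (0 : ℝ) < t := by
      have := mul_pos hr hL
      rwa [div_mul_cancel₀ _ hL.ne'] at this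
    rw [hpos] at h
    have h' := h.comp_affine (a := sm) (b := sm + t) (inv_pos.2 hr) (by field_simp; ring)
    refine ⟨_, he.comp_affine sm (t / (sp - sm))⁻¹ sm, ?_⟩
    rwa [← mul_assoc, ← Complex.ofReal_mul, inv_mul_cancel₀ hr.ne', Complex.ofReal_one,
      one_mul] at h'

/-- The minimal modulus on a ray is attained. -/
lemma exists_isLeast_moduli (hn : n₁ ^ 2 ≤ n₂ ^ 2) (hab : a < b) (hη : ηm ≠ ηp)
    (hne : (moduli n₁ n₂ a b γ ηm ηp).Nonempty) :
    ∃ ρ, IsLeast (moduli n₁ n₂ a b γ ηm ηp) ρ := by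
  have hbdd : BddBelow (moduli n₁ n₂ a b γ ηm ηp) := ⟨0, fun ρ hρ => hρ.1.le⟩
  obtain ⟨u, -, hu, hmem⟩ := exists_seq_tendsto_sInf hne hbdd
  choose hpos es hes hj using hmem
  -- A minimising sequence of moduli converges, and the associated joining problems pass to the
  -- limit.
  obtain ⟨e, hem, heb, h⟩ := Joins.of_tendsto hab.le
    (((Complex.continuous_ofReal.tendsto _).comp hu).mul_const (Complex.exp (Complex.I * γ)))
    (sq_nonneg n₁) hn (fun n => (hes n).measurable) (fun n => (hes n).mem) hj
  refine ⟨_, ⟨?_, e, ⟨hem, heb⟩, h⟩, fun ρ hρ => csInf_le hbdd hρ⟩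
  refine lt_of_le_of_ne (ge_of_tendsto' hu fun n => (hpos n).le) fun h0 => hη ?_
  exact h.eq_of_eq_or_eq_zero hab.le (Or.inr (by rw [← h0]; simp))

lemma rhoMin_eq_of_isLeast (hn : n₁ ^ 2 ≤ n₂ ^ 2) (hab : a < b)
    (hγ : γ ∈ Ioc (-Real.pi) Real.pi) {ρ : ℝ} (hρ : IsLeast (moduli n₁ n₂ a b γ ηm ηp) ρ) :
    rhoMin n₁ n₂ a b ηm ηp γ = ENNReal.ofReal ρ := by
  refine le_antisymm ?_ (le_iInf₂ fun κ' hκ' => ?_)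
  · refine iInf₂_le_of_le _ ((mem_achievable_and_arg_iff hn hab hγ).2 ⟨ρ, hρ.1, rfl⟩) ?_
    rw [norm_ofReal_mul_exp hρ.1.1]
  · obtain ⟨ρ', hρ', rfl⟩ := (mem_achievable_and_arg_iff hn hab hγ).1 hκ'
    rw [norm_ofReal_mul_exp hρ'.1]
    exact ENNReal.ofReal_le_ofReal (hρ.2 hρ')

/-- The minimal time is attained, at the rescaled minimal modulus. -/
lemma Tmin_eq_of_isLeast (hn : n₁ ^ 2 ≤ n₂ ^ 2) (hs : sm < sp) (hη : ηm ≠ ηp) (hκ : κ ≠ 0) {ρ : ℝ}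
    (hρ : IsLeast (moduli n₁ n₂ sm sp κ.arg ηm ηp) ρ) :
    ∃ t : ℝ≥0, (t : ℝ) = (sp - sm) * ρ / ‖κ‖ ∧ (t : ℝ≥0∞) = Tmin n₁ n₂ sm κ ηm ηp ∧
      ηm ∈ controllableAt n₁ n₂ sm ηp κ t := by
  have hL : 0 < sp - sm := sub_pos.2 hs
  have hκ' : 0 < ‖κ‖ := norm_pos_iff.2 hκ
  obtain ⟨t, ht⟩ : ∃ t : ℝ≥0, (t : ℝ) = (sp - sm) * ρ / ‖κ‖ :=
    ⟨_, Real.coe_toNNReal _ (div_nonneg (mul_nonneg hL.le hρ.1.1.le) hκ'.le)⟩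
  have hmem : ηm ∈ controllableAt n₁ n₂ sm ηp κ t := by
    rw [mem_controllableAt_iff_moduli hn hs hη hκ, ht]
    convert hρ.1 using 1
    field_simp
  refine ⟨t, ht, le_antisymm (le_iInf₂ fun t' ht' => ?_) (iInf₂_le t hmem), hmem⟩
  have h := hρ.2 ((mem_controllableAt_iff_moduli hn hs hη hκ).1 ht')
  rw [ENNReal.coe_le_coe, ← NNReal.coe_le_coe, ht, div_le_iff₀ hκ']
  rw [le_div_iff₀ hL] at h
  linarith

end Moduli

/-! ### Minimum-time controls and resonators of minimal modulus. -/

/-- Along the ray through `κ`, restriction of minimum-time controls to an interval whose length is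
the minimal time gives the resonators of minimal modulus. -/
lemma image_restrictLinf_minTimeControls {n₁ n₂ sm sp : ℝ} (hn : n₁ ^ 2 ≤ n₂ ^ 2) (hs : sm < sp)
    (hκ : κ ≠ 0) (hT : ENNReal.ofReal (sp - sm) = Tmin n₁ n₂ sm κ ηm ηp)
    (hρ : rhoMin n₁ n₂ sm sp ηm ηp κ.arg = ENNReal.ofReal ‖κ‖) :
    restrictLinf Ioo_subset_Ioi_self '' minTimeControls n₁ n₂ sm κ ηm ηp =
      minModulusResonators n₁ n₂ sm sp ηm ηp κ.arg := by
  have hL : 0 < sp - sm := sub_pos.2 hs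
  have hsub : Ioo sm sp ⊆ Ioi sm := Ioo_subset_Ioi_self
  have hray : Complex.exp (Complex.I * κ.arg) *
      ((rhoMin n₁ n₂ sm sp ηm ηp κ.arg).toReal : ℂ) = κ := by
    rw [hρ, ENNReal.toReal_ofReal (norm_nonneg κ), mul_comm, norm_mul_exp_arg]
  have hend : ∀ t : ℝ≥0, (t : ℝ≥0∞) = Tmin n₁ n₂ sm κ ηm ηp → sm + t = sp := fun t ht => by
    rw [← hT] at ht
    have := congrArg ENNReal.toReal ht
    rw [ENNReal.coe_toReal, ENNReal.toReal_ofReal hL.le] at this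
    rw [this]; ring
  have hr : ∀ ε : Linf (Ioi sm),
      restrictLinf hsub ε =ᵐ[volume.restrict (Ioo sm sp)] ε := fun ε => MemLp.coeFn_toLp _
  have hac : ∀ {f g : ℝ → ℝ}, f =ᵐ[volume.restrict (Ioi sm)] g →
      f =ᵐ[volume.restrict (Ioo sm sp)] g := fun h =>
    ae_mono (Measure.restrict_mono hsub le_rfl) h
  ext ε'
  constructor
  · rintro ⟨ε, ⟨hε, t, ht, hst⟩, rfl⟩
    obtain ⟨e, he, hee⟩ := Feasible.exists_isControl hn hε
    have hj := (steers_iff_of_ae (sq_nonneg n₁) he hee).1 hst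
    rw [hend t ht] at hj
    have hee' : e =ᵐ[volume.restrict (Ioo sm sp)] restrictLinf hsub ε :=
      (hac hee).trans (hr ε).symm
    refine ⟨?_, by rw [hρ]; exact ENNReal.ofReal_ne_top, ?_⟩
    · filter_upwards [hee'] with s hs
      rw [← hs]; exact he.mem s
    · rw [hray]
      exact (mem_eigenvalues_iff_of_ae hκ hs (sq_nonneg n₁) he hee').2 hj
  · rintro ⟨hε', -, h⟩
    rw [hray] at h
    obtain ⟨e, he, hee'⟩ := Feasible.exists_isControl hn hε'
    -- The coefficient `e` lives on the whole line, so it also extends the resonator to a feasible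
    -- control on the half-line.
    obtain ⟨ε, hε, hee⟩ := he.exists_feasible (Ioi sm)
    have hj := (mem_eigenvalues_iff_of_ae hκ hs (sq_nonneg n₁) he hee').1 h
    have ht : (((sp - sm).toNNReal : ℝ≥0) : ℝ≥0∞) = Tmin n₁ n₂ sm κ ηm ηp := hT
    refine ⟨ε, ⟨hε, _, ht, (steers_iff_of_ae (sq_nonneg n₁) he hee).2 (by rwa [hend _ ht])⟩, ?_⟩
    exact Lp.ext (((hr ε).trans (hac hee).symm).trans hee')

end Reduction

end Resonator

end

/-! ### The main theorem. -/

theorem theorem3p2 (n₁ n₂ : ℝ) (hn₁ : 0 < n₁) (hn₂ : n₁ < n₂) (sm sp : ℝ) (hs : sm < sp)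
    (ηm ηp : Resonator.Sphere) (hη : ηm ≠ ηp) (κ : ℂ) (hκ : κ ≠ 0) (γ : ℝ) (hγ : γ = κ.arg) :
    List.TFAE [
      ηm ∈ Resonator.controllableBefore n₁ n₂ sm ηp κ ⊤,
      (Resonator.minTimeControls n₁ n₂ sm κ ηm ηp).Nonempty,
      γ ∈ Complex.arg '' Resonator.achievable n₁ n₂ sm sp ηm ηp,
      (Resonator.minModulusResonators n₁ n₂ sm sp ηm ηp γ).Nonempty] ∧
    (ηm ∈ Resonator.controllableBefore n₁ n₂ sm ηp κ ⊤ →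
      Resonator.Tmin n₁ n₂ sm κ ηm ηp =
        ENNReal.ofReal (sp - sm) * Resonator.rhoMin n₁ n₂ sm sp ηm ηp γ / ENNReal.ofReal ‖κ‖ ∧
      (ENNReal.ofReal (sp - sm) = Resonator.Tmin n₁ n₂ sm κ ηm ηp →
        Resonator.restrictLinf Ioo_subset_Ioi_self '' Resonator.minTimeControls n₁ n₂ sm κ ηm ηp =
          Resonator.minModulusResonators n₁ n₂ sm sp ηm ηp γ)) := by
  subst hγ
  have hn : n₁ ^ 2 ≤ n₂ ^ 2 := pow_le_pow_left₀ hn₁.le hn₂.le 2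
  have hL : 0 < sp - sm := sub_pos.2 hs
  have hκ' : 0 < ‖κ‖ := norm_pos_iff.2 hκ
  have hγ := Complex.arg_mem_Ioc κ
  have hcontr : ηm ∈ Resonator.controllableBefore n₁ n₂ sm ηp κ ⊤ →
      (Resonator.moduli n₁ n₂ sm sp κ.arg ηm ηp).Nonempty := by
    simp only [Resonator.controllableBefore, mem_iUnion]
    rintro ⟨t, -, ht⟩
    exact ⟨_, (Resonator.mem_controllableAt_iff_moduli hn hs hη hκ).1 ht⟩
  refine ⟨?_, fun hc => ?_⟩
  · tfae_have 1 → 3 := fun h => by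
      obtain ⟨ρ, hρ⟩ := hcontr h
      exact ⟨_, (Resonator.mem_achievable_and_arg_iff hn hs hγ).2 ⟨ρ, hρ, rfl⟩⟩
    tfae_have 3 → 4 := by
      rintro ⟨κ', h⟩
      obtain ⟨ρ', hρ', -⟩ := (Resonator.mem_achievable_and_arg_iff hn hs hγ).1 h
      obtain ⟨ρ, hρ⟩ := Resonator.exists_isLeast_moduli hn hs hη ⟨ρ', hρ'⟩
      obtain ⟨hpos, e, he, hj⟩ := hρ.1
      obtain ⟨ε, hε, hee⟩ := he.exists_feasible (Ioo sm sp)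
      have hmin := Resonator.rhoMin_eq_of_isLeast hn hs hγ hρ
      refine ⟨ε, hε, by rw [hmin]; exact ENNReal.ofReal_ne_top, ?_⟩
      rw [hmin, ENNReal.toReal_ofReal hpos.le, mul_comm]
      exact (Resonator.mem_eigenvalues_iff_of_ae (Resonator.ofReal_mul_exp_ne_zero hpos _) hs
        (sq_nonneg n₁) he hee).2 hj
    tfae_have 4 → 2 := by
      rintro ⟨ε, hε, -, h⟩
      rw [mul_comm] at h
      -- Eigenvalues are nonzero by definition, so the minimal modulus is positive and the
      -- eigenvalue has argument exactly `κ.arg`.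
      have hpos : 0 < (Resonator.rhoMin n₁ n₂ sm sp ηm ηp κ.arg).toReal := by
        refine lt_of_le_of_ne ENNReal.toReal_nonneg fun h0 => h.1 ?_
        rw [← h0]; simp
      have hach := (Resonator.mem_achievable_and_arg_iff hn hs hγ).1
        ⟨mem_iUnion₂.2 ⟨ε, hε, h⟩, Resonator.arg_ofReal_mul_exp hpos hγ⟩
      obtain ⟨ρ', hρ', -⟩ := hach
      obtain ⟨ρ, hρ⟩ := Resonator.exists_isLeast_moduli hn hs hη ⟨ρ', hρ'⟩
      obtain ⟨t, -, ht, ε', hε', hst⟩ := Resonator.Tmin_eq_of_isLeast hn hs hη hκ hρ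
      exact ⟨ε', hε', t, ht, hst⟩
    tfae_have 2 → 1 := by
      rintro ⟨ε, hε, t, -, hst⟩
      exact mem_iUnion₂.2 ⟨t, ENNReal.coe_lt_top, ε, hε, hst⟩
    tfae_finish
  · obtain ⟨ρ, hρ⟩ := Resonator.exists_isLeast_moduli hn hs hη (hcontr hc)
    have hmin := Resonator.rhoMin_eq_of_isLeast hn hs hγ hρ
    obtain ⟨t, hteq, ht, -⟩ := Resonator.Tmin_eq_of_isLeast hn hs hη hκ hρ
    have hT : Resonator.Tmin n₁ n₂ sm κ ηm ηp = ENNReal.ofReal ((sp - sm) * ρ / ‖κ‖) := by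
      rw [← ht, ← hteq, ENNReal.ofReal_coe_nnreal]
    refine ⟨?_, fun hlen => ?_⟩
    · rw [hT, hmin, ENNReal.ofReal_div_of_pos hκ', ENNReal.ofReal_mul hL.le]
    · refine Resonator.image_restrictLinf_minTimeControls hn hs hκ hlen ?_
      rw [hmin]
      -- Interval length equal to (sp - sm)ρ/‖κ‖ forces ρ = ‖κ‖, so the minimal eigenvalue on the
      -- ray is κ itself.
      rw [hT, ENNReal.ofReal_eq_ofReal_iff hL.le (hteq ▸ t.2), eq_div_iff hκ'.ne'] at hlen
      rw [mul_left_cancel₀ hL.ne' hlen]
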